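/- **Theorem 3.1 (infinite strip).** Let $n\ge 2$. Let $\mathbb H_n=\mathbb C^n\times\mathbb R$ be the Heisenberg group with $[z,t]\cdot[z',t']=[z+z',\,t+t'+2\,\mathrm{Im}\, z\cdot\bar z']$, let $Z_j=\partial_{z_j}+i\bar z_j\partial_t$, $\bar Z_j=\partial_{\bar z_j}-iz_j\partial_t$ and $L_0=-\tfrac12\sum_{j=1}^n(\bar Z_jZ_j+Z_j\bar Z_j)$. Let $g_e([z,t])=a_0(|z|^4+t^2)^{-n/2}$ with $a_0=2^{n-2}\Gamma(n/2)^2/\pi^{n+1}$, and $g_\zeta(\xi)=g_e(\xi^{-1}\zeta)$. Write $\bar f([z,t])=\frac1{2\pi}\int_0^{2\pi}f([e^{i\theta}z,t])\,d\theta$, and call $f$ circular if $f([e^{i\theta}z,t])=f([z,t])$ for all $\theta$ and all $[z,t]$. Let $I=\{[z',t']\in\mathbb H_n:0<t'<1\}$, and fix $\eta=[z,t]\in I$. For $s\in\mathbb R$ and $\xi=[z',t']$ put $$H(s)=a_0|C_{-s}|^{-n}F\Big(\tfrac n2,\tfrac n2;1;\tfrac{|P|^2}{|C_{-s}|^2}\Big),\qquad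 C_{-s}=|z|^2+|z'|^2+i(t'-s),\quad P=2z\cdot\bar z',$$ where $F$ is the Gaussian hypergeometric function. Let $$G'(\eta,\xi)=\sum_{m\ge0}H(2m+t)-\sum_{m\ge0}H(-2m-t)+\sum_{m\ge1}H(-2m+t)-\sum_{m\ge1}H(2m-t),$$ and let $S_\eta=\{[e^{i\theta}z,t]:\theta\in\mathbb R\}$. Then: 1. For every $s\in\mathbb R$ and every $\xi\notin S_{[z,s]}$, $H(s)$ is the circular average $\overline{g_{[z,s]}}(\xi)$ of the fundamental solution with pole $[z,s]$. 2. Each of the four series converges locally uniformly in $\xi$ on $I\setminus S_\eta$. 3. $\xi\mapsto G'(\eta,\xi)$ is $C^\infty$ on $I\setminus S_\eta$, and $G'(\eta,\cdot)-H(t)$ is $C^\infty$ on all of $I$. 4. $G'(\eta,\cdot)$ is locally integrable on $I$, and $L_0G'(\eta,\cdot)=\delta_\eta$ on circular functions: $\int_I G'(\eta,\xi)\,L_0\varphi(\xi)\,d\xi=\varphi(\eta)$ for every circular $\varphi\in C_c^\infty(I)$, where $d\xi$ is Lebesgue measure. More generally, this integral equals $\bar\varphi(\eta)$ for every $\varphi\in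 C_c^\infty(I)$. 5. For every $w\in\mathbb C^n$, $G'(\eta,\xi)\to0$ as $\xi\to[w,0]$ and as $\xi\to[w,1]$ with $\xi\in I$. Thus $G'$ is a Green's function for $I$ on circular data. -/

import Mathlib

open scoped ContDiff Topology

namespace Heisenberg

/-- The underlying space `ℂⁿ × ℝ` of the Heisenberg group `ℍ_n`; its points are `[z, t]`.
Its product topology, smooth structure and Lebesgue measure are the usual ones of `ℝ²ⁿ⁺¹`
(the Lebesgue measure is the Haar measure of the group). -/
abbrev Heis (n : ℕ) : Type := (Fin n → ℂ) × ℝ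

variable {n : ℕ}

/-- `z · w̄ = ∑ z_j w̄_j`. -/
noncomputable def herm (z w : Fin n → ℂ) : ℂ := ∑ j, z j * starRingEnd ℂ (w j)

/-- `|z|² = ∑ |z_j|²`. -/
noncomputable def normSq (z : Fin n → ℂ) : ℝ := ∑ j, ‖z j‖ ^ 2

/-- The group law `[z, t] · [z', t'] = [z + z', t + t' + 2 Im (z · z̄')]`. -/
noncomputable def mul (ξ ζ : Heis n) : Heis n :=
  (ξ.1 + ζ.1, ξ.2 + ζ.2 + 2 * (herm ξ.1 ζ.1).im)

/-- The group inverse `[z, t]⁻¹ = [-z, -t]`. -/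
def inv (ξ : Heis n) : Heis n := (-ξ.1, -ξ.2)

/-- The derivative `∂_{x_j}`, where `z_j = x_j + i y_j`. -/
noncomputable def dx (j : Fin n) (f : Heis n → ℂ) (ξ : Heis n) : ℂ :=
  fderiv ℝ f ξ (Pi.single j 1, 0)

/-- The derivative `∂_{y_j}`, where `z_j = x_j + i y_j`. -/
noncomputable def dy (j : Fin n) (f : Heis n → ℂ) (ξ : Heis n) : ℂ :=
  fderiv ℝ f ξ (Pi.single j Complex.I, 0)

/-- The vector field `T = ∂_t`. -/
noncomputable def T (f : Heis n → ℂ) (ξ : Heis n) : ℂ := fderiv ℝ f ξ (0, 1)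

/-- `Z_j = ∂_{z_j} + i z̄_j ∂_t` with `∂_{z_j} = (∂_{x_j} - i ∂_{y_j}) / 2`. -/
noncomputable def Z (j : Fin n) (f : Heis n → ℂ) (ξ : Heis n) : ℂ :=
  (dx j f ξ - Complex.I * dy j f ξ) / 2 + Complex.I * starRingEnd ℂ (ξ.1 j) * T f ξ

/-- `Z̄_j = ∂_{z̄_j} - i z_j ∂_t` with `∂_{z̄_j} = (∂_{x_j} + i ∂_{y_j}) / 2`. -/
noncomputable def Zbar (j : Fin n) (f : Heis n → ℂ) (ξ : Heis n) : ℂ :=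
  (dx j f ξ + Complex.I * dy j f ξ) / 2 - Complex.I * ξ.1 j * T f ξ

/-- The sub-Laplacian `Δ₀ = 2 ∑ (Z̄_j Z_j + Z_j Z̄_j)`. -/
noncomputable def subLaplacian (f : Heis n → ℂ) (ξ : Heis n) : ℂ :=
  2 * ∑ j, (Zbar j (Z j f) ξ + Z j (Zbar j f) ξ)

/-- `L₀ = -Δ₀ / 4`. -/
noncomputable def L0 (f : Heis n → ℂ) (ξ : Heis n) : ℂ := -(1 / 4) * subLaplacian f ξ

/-- The constant `a₀ = 2ⁿ⁻² Γ(n/2)² / πⁿ⁺¹`. -/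
noncomputable def a0 (n : ℕ) : ℝ :=
  (2 : ℝ) ^ ((n : ℤ) - 2) * Real.Gamma ((n : ℝ) / 2) ^ 2 / Real.pi ^ (n + 1)

/-- The fundamental solution of `L₀` with pole at the identity, `a₀ (|z|⁴ + t²)^{-n/2}`. -/
noncomputable def gE (ξ : Heis n) : ℝ :=
  a0 n * (normSq ξ.1 ^ 2 + ξ.2 ^ 2) ^ (-(n : ℝ) / 2)

/-- The fundamental solution with pole at `η`, `g_η(ξ) = g_e(ξ⁻¹ η)`. -/
noncomputable def g (η ξ : Heis n) : ℝ := gE (mul (inv ξ) η)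

/-- The rotation `[z, t] ↦ [e^{iθ} z, t]`. -/
noncomputable def rot (θ : ℝ) (ξ : Heis n) : Heis n :=
  (fun j => Complex.exp (θ * Complex.I) * ξ.1 j, ξ.2)

/-- The circular average `f̄([z, t]) = (1/2π) ∫₀^{2π} f([e^{iθ} z, t]) dθ`. -/
noncomputable def average {E : Type*} [NormedAddCommGroup E] [NormedSpace ℝ E]
    (f : Heis n → E) (ξ : Heis n) : E :=
  (2 * Real.pi)⁻¹ • ∫ θ in (0 : ℝ)..(2 * Real.pi), f (rot θ ξ)

/-- Circular functions: those invariant under all rotations `[z, t] ↦ [e^{iθ} z, t]`. -/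
def IsCircular {E : Type*} (f : Heis n → E) : Prop := ∀ (θ : ℝ) (ξ : Heis n), f (rot θ ξ) = f ξ

/-- The circle `{[e^{iθ} z, t] : θ ∈ ℝ}` through `η = [z, t]` (a single point if `z = 0`). -/
def circleThrough (η : Heis n) : Set (Heis n) := Set.range fun θ : ℝ => rot θ η

/-- `C_{-s} = |z|² + |z'|² + i (t' - s)` for `η = [z, t]`, `ξ = [z', t']`. -/
noncomputable def C (s : ℝ) (η ξ : Heis n) : ℂ :=
  ((normSq η.1 + normSq ξ.1 : ℝ) : ℂ) + Complex.I * ((ξ.2 - s : ℝ) : ℂ)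

/-- `P = 2 z · z̄'` for `η = [z, t]`, `ξ = [z', t']`. -/
noncomputable def P (η ξ : Heis n) : ℂ := 2 * herm η.1 ξ.1

/-- `H(s) = a₀ |C_{-s}|^{-n} F(n/2, n/2; 1; |P|² / |C_{-s}|²)` as a function of `(η, ξ)`,
with `F` the Gaussian hypergeometric function: the circular average of the fundamental
solution with pole `[z, s]`, where `η = [z, t]`. -/
noncomputable def H (s : ℝ) (η ξ : Heis n) : ℝ :=
  a0 n * ‖C s η ξ‖ ^ (-(n : ℝ)) *
    ordinaryHypergeometric ((n : ℝ) / 2) ((n : ℝ) / 2) (1 : ℝ) (‖P η ξ‖ ^ 2 / ‖C s η ξ‖ ^ 2)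

/-- The infinite strip `I = {[z', t'] : 0 < t' < 1}`. -/
def strip (n : ℕ) : Set (Heis n) := {ξ | 0 < ξ.2 ∧ ξ.2 < 1}

/-- `G'(η, ξ)` for `η = [z, t]`: the series over `m ≥ 1` are indexed by `m + 1`, `m ≥ 0`. -/
noncomputable def G' (η ξ : Heis n) : ℝ :=
  (∑' m : ℕ, H (2 * (m : ℝ) + η.2) η ξ) - (∑' m : ℕ, H (-2 * (m : ℝ) - η.2) η ξ)
    + (∑' m : ℕ, H (-2 * ((m : ℝ) + 1) + η.2) η ξ)
    - (∑' m : ℕ, H (2 * ((m : ℝ) + 1) - η.2) η ξ)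

/-- Test functions on the strip: smooth with compact support inside it. -/
def IsTest (φ : Heis n → ℂ) : Prop :=
  ContDiff ℝ ∞ φ ∧ HasCompactSupport φ ∧ tsupport φ ⊆ strip n

end Heisenberg

/-! This is the method of images. The planes `t' = 0` and `t' = 1` are not symmetric for `g`, since
the group law twists the `t`-coordinate by `Im P`. After circular averaging the twist disappears:
`g` with pole `[z, s]` equals `a₀ |C - P|⁻ⁿ`, a rotation of `ξ` multiplies `P` by a phase and fixes
`C`, and so the average sees only `|P|` and `|C|`. Expanding `(1 - w)^(-n/2)` with `w = P / C` and
applying Parseval gives the hypergeometric form (`H_eq_average`). Thus `H s` depends on `s` only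
through `(t' - s)²` (`H_congr`), and poles reflected in a boundary plane cancel there (`G'_bottom`,
`G'_top`).

Of all the image poles only `t` lies in the closed strip. Far poles contribute `O(|s|⁻ⁿ)`, which is
summable for `n ≥ 2`. In the variable `σ = 1/s` the terms are `|σ|ⁿ` times slices of one function
smooth across `σ = 0`, so the series can be differentiated to every order (`contDiffAt_tsum_H`).

That `g` is a fundamental solution comes from the regularisation `a₀ |A_e|⁻ⁿ`, `A_e = C - P + e`.
Since `Z_j` kills `A_e` and `Z̄_j` kills its conjugate, `L₀` of it is explicit (`L0_regSol`). For `e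
= ε²` it is a dilated kernel of mass one, so `ε → 0` gives `integral_g_mul_L0`. Averaging over the
pole makes `L₀ H(s)` the uniform mass on a circle (`integral_H_mul_L0`), and summing over the images
leaves only the circle through `η`. -/

/-! ### Circular averages and the hypergeometric function -/

open MeasureTheory in
/-- Parseval's identity for an absolutely convergent series of exponentials. -/
theorem integral_normSq_tsum_exp (b : ℕ → ℂ) (hb : Summable fun k => ‖b k‖) :
    ∫ θ in (0 : ℝ)..(2 * Real.pi), ‖∑' k, b k * Complex.exp (-(θ * Complex.I)) ^ k‖ ^ 2 =
      2 * Real.pi * ∑' k, ‖b k‖ ^ 2 := by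
  have hnorm : ∀ (θ : ℝ) (k : ℕ), ‖b k * Complex.exp (-(θ * Complex.I)) ^ k‖ = ‖b k‖ := by
    intro θ k
    have : -((θ : ℂ) * Complex.I) = ((-θ : ℝ) : ℂ) * Complex.I := by push_cast; ring
    rw [norm_mul, norm_pow, this, Complex.norm_exp_ofReal_mul_I, one_pow, mul_one]
  -- The squared modulus is expanded as a double series, majorised by `‖b k‖ ‖b l‖` and integrated
  -- term by term; orthogonality leaves the diagonal.
  set F : ℕ × ℕ → ℝ → ℂ := fun p θ => (b p.1 * Complex.exp (-(θ * Complex.I)) ^ p.1) *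
    starRingEnd ℂ (b p.2 * Complex.exp (-(θ * Complex.I)) ^ p.2) with hF
  have hFnorm : ∀ p θ, ‖F p θ‖ = ‖b p.1‖ * ‖b p.2‖ := by
    intro p θ
    simp only [hF]
    rw [norm_mul, RCLike.norm_conj, hnorm, hnorm]
  have hbb : Summable fun p : ℕ × ℕ => ‖b p.1‖ * ‖b p.2‖ :=
    hb.mul_of_nonneg hb (fun _ => norm_nonneg _) (fun _ => norm_nonneg _)
  have hFc : ∀ p, Continuous (F p) := by
    intro p; simp only [hF]
    exact (by fun_prop : Continuous fun θ : ℝ => b p.1 * Complex.exp (-(θ * Complex.I)) ^ p.1).mul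
      (Complex.continuous_conj.comp
        (by fun_prop : Continuous fun θ : ℝ => b p.2 * Complex.exp (-(θ * Complex.I)) ^ p.2))
  have hsum : ∀ θ : ℝ, ∑' p, F p θ =
      ((‖∑' k, b k * Complex.exp (-(θ * Complex.I)) ^ k‖ ^ 2 : ℝ) : ℂ) := by
    intro θ
    have h1 : Summable fun k => ‖b k * Complex.exp (-(θ * Complex.I)) ^ k‖ := by
      simpa only [hnorm] using hb
    have h2 : Summable fun k => ‖starRingEnd ℂ (b k * Complex.exp (-(θ * Complex.I)) ^ k)‖ := by
      simpa only [RCLike.norm_conj] using h1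
    have := tsum_mul_tsum_of_summable_norm h1 h2
    simp only [hF]
    rw [← this, ← Complex.conj_tsum, Complex.mul_conj, Complex.normSq_eq_norm_sq]
  have hint : HasSum (fun p => ∫ θ in (0 : ℝ)..(2 * Real.pi), F p θ)
      (∫ θ in (0 : ℝ)..(2 * Real.pi), ∑' p, F p θ) := by
    apply intervalIntegral.hasSum_integral_of_dominated_convergence
      (fun p _ => ‖b p.1‖ * ‖b p.2‖)
    · exact fun p => (hFc p).aestronglyMeasurable
    · exact fun p => Filter.Eventually.of_forall fun θ _ => (hFnorm p θ).le
    · exact Filter.Eventually.of_forall fun θ _ => hbb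
    · exact intervalIntegrable_const
    · refine Filter.Eventually.of_forall fun θ _ => ?_
      exact (Summable.of_norm (by simpa only [hFnorm] using hbb)).hasSum
  have hval : ∀ p, ∫ θ in (0 : ℝ)..(2 * Real.pi), F p θ =
      if p.1 = p.2 then ((2 * Real.pi * ‖b p.1‖ ^ 2 : ℝ) : ℂ) else 0 := by
    rintro ⟨k, l⟩
    have hFe : ∀ θ : ℝ, F (k, l) θ = b k * starRingEnd ℂ (b l) *
        Complex.exp ((((l : ℂ) - k) * Complex.I) * θ) := by
      intro θ
      simp only [hF]
      rw [map_mul, map_pow, ← Complex.exp_conj, ← Complex.exp_nat_mul, ← Complex.exp_nat_mul,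
        mul_mul_mul_comm, ← Complex.exp_add]
      simp only [map_neg, map_mul, Complex.conj_I, Complex.conj_ofReal]
      congr 2
      ring
    simp only [hFe]
    rw [intervalIntegral.integral_const_mul]
    split_ifs with h
    · subst h
      simp only [sub_self, zero_mul, Complex.exp_zero, intervalIntegral.integral_const, sub_zero]
      rw [Complex.mul_conj, Complex.normSq_eq_norm_sq]
      simp [mul_comm]
    · have hne : ((l : ℂ) - k) * Complex.I ≠ 0 :=
        mul_ne_zero (sub_ne_zero.mpr (by exact_mod_cast Ne.symm h)) Complex.I_ne_zero
      rw [integral_exp_mul_complex hne]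
      have : ((l : ℂ) - k) * Complex.I * ((2 * Real.pi : ℝ) : ℂ) =
          ((l - k : ℤ) : ℂ) * (2 * Real.pi * Complex.I) := by push_cast; ring
      rw [this, Complex.exp_int_mul_two_pi_mul_I]
      simp
  have hfin : HasSum (fun k => ((2 * Real.pi * ‖b k‖ ^ 2 : ℝ) : ℂ))
      (∫ θ in (0 : ℝ)..(2 * Real.pi), ∑' p, F p θ) := by
    have hinj : Function.Injective fun k : ℕ => (k, k) := fun a b h => (Prod.mk.inj h).1
    refine ((hinj.hasSum_iff (f := fun p => ∫ θ in (0 : ℝ)..(2 * Real.pi), F p θ) ?_).mpr hint).congr_fun ?_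
    · rintro ⟨k, l⟩ hkl
      rw [hval, if_neg]
      rintro (rfl : k = l)
      exact hkl ⟨k, rfl⟩
    · intro k
      simp [hval]
  simp only [hsum] at hfin
  rw [intervalIntegral.integral_ofReal, Complex.hasSum_ofReal] at hfin
  rw [← hfin.tsum_eq, tsum_mul_left]

/-- With `x = w e^{-iθ}`, the integrand is `|(1 - x)^{-a}|²`, and the binomial coefficients of `(1 -
x)^{-a}` are `c k = (a)_k / k!`. Parseval yields `∑ c_k² |w|^{2k}`, and `c_k²` is the coefficient of
`F(a, a; 1; ·)` because `(1)_k = k!`. -/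
theorem circleAverage_norm_one_sub_rpow {a : ℝ} {w : ℂ} (hw : ‖w‖ < 1) :
    ∫ θ in (0 : ℝ)..(2 * Real.pi), ‖1 - w * Complex.exp (-(θ * Complex.I))‖ ^ (-(2 * a)) =
      2 * Real.pi * ordinaryHypergeometric a a (1 : ℝ) (‖w‖ ^ 2) := by
  set c : ℕ → ℝ := fun k => Ring.choose (a + k - 1) k with hc
  have hps : ∀ x : ℂ, ‖x‖ < 1 → HasSum (fun k => (c k : ℂ) * x ^ k) (1 / (1 - x) ^ (a : ℂ)) := by
    intro x hx
    have := (Complex.one_div_one_sub_cpow_hasFPowerSeriesOnBall_zero (a : ℂ)).hasSum (y := x)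
      (by
        rw [Metric.mem_eball, edist_zero_right, ← ofReal_norm]
        exact ENNReal.ofReal_lt_one.mpr hx)
    simp only [FormalMultilinearSeries.ofScalars_apply_eq, zero_add, smul_eq_mul] at this
    refine this.congr_fun fun k => ?_
    simp only [hc]
    rw [Complex.ofReal_choose]
    push_cast
    rfl
  have hcoef : ∀ k, ordinaryHypergeometricCoefficient a a (1 : ℝ) k = c k ^ 2 := by
    intro k
    have h1 : (k.factorial : ℝ) * c k = (ascPochhammer ℝ k).eval a := by
      simp only [hc]
      rw [← Ring.multichoose_eq, ← nsmul_eq_mul, Ring.factorial_nsmul_multichoose_eq_ascPochhammer,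
        Polynomial.ascPochhammer_smeval_eq_eval]
    have h2 : (k.factorial : ℝ) ≠ 0 := by positivity
    simp only [ordinaryHypergeometricCoefficient, ← h1, ascPochhammer_eval_one]
    field_simp
  have hsw : Summable fun k => ‖(c k : ℂ) * w ^ k‖ := (hps w hw).summable.norm
  have h := integral_normSq_tsum_exp _ hsw
  have hL : ∀ θ : ℝ, ‖1 - w * Complex.exp (-(θ * Complex.I))‖ ^ (-(2 * a)) =
      ‖∑' k, (c k : ℂ) * w ^ k * Complex.exp (-(θ * Complex.I)) ^ k‖ ^ 2 := by
    intro θ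
    have hx : ‖w * Complex.exp (-(θ * Complex.I))‖ < 1 := by
      have : -((θ : ℂ) * Complex.I) = ((-θ : ℝ) : ℂ) * Complex.I := by push_cast; ring
      rw [norm_mul, this, Complex.norm_exp_ofReal_mul_I, mul_one]
      exact hw
    have h1 : 1 - w * Complex.exp (-(θ * Complex.I)) ≠ 0 := by
      intro h0
      rw [← sub_eq_zero.mp h0] at hx
      simp at hx
    have := (hps _ hx).tsum_eq
    simp only [mul_pow, ← mul_assoc] at this
    rw [this, norm_div, norm_one, Complex.norm_cpow_real, one_div, ← Real.rpow_neg (norm_nonneg _),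
      ← Real.rpow_natCast, ← Real.rpow_mul (norm_nonneg _)]
    congr 1
    push_cast
    ring
  simp only [hL]
  rw [h, ordinaryHypergeometric_eq_tsum]
  congr 1
  refine tsum_congr fun k => ?_
  have := hcoef k
  simp only [ordinaryHypergeometricCoefficient] at this
  rw [this, norm_mul, norm_pow, mul_pow, Complex.norm_real, Real.norm_eq_abs, sq_abs, smul_eq_mul]
  ring

namespace Heisenberg

variable {n : ℕ}

theorem normSq_nonneg (z : Fin n → ℂ) : 0 ≤ normSq z :=
  Finset.sum_nonneg fun _ _ => by positivity

theorem normSq_eq_zero {z : Fin n → ℂ} : normSq z = 0 ↔ z = 0 := by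
  rw [normSq, Finset.sum_eq_zero_iff_of_nonneg fun _ _ => by positivity]
  simp [funext_iff]

theorem normSq_neg (z : Fin n → ℂ) : normSq (-z) = normSq z := by simp [normSq]

theorem a0_nonneg (n : ℕ) : 0 ≤ a0 n := by unfold a0; positivity

theorem C_re (s : ℝ) (η ξ : Heis n) : (C s η ξ).re = normSq η.1 + normSq ξ.1 := by simp [C]

theorem C_im (s : ℝ) (η ξ : Heis n) : (C s η ξ).im = ξ.2 - s := by simp [C]

theorem norm_C_sq (s : ℝ) (η ξ : Heis n) :
    ‖C s η ξ‖ ^ 2 = (normSq η.1 + normSq ξ.1) ^ 2 + (ξ.2 - s) ^ 2 := by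
  rw [← Complex.normSq_eq_norm_sq, Complex.normSq_apply, C_re, C_im]; ring

theorem normSq_sub (z w : Fin n → ℂ) :
    normSq (z - w) = normSq z + normSq w - (2 * herm z w).re := by
  simp only [normSq, herm, Finset.mul_sum, Complex.re_sum, ← Finset.sum_add_distrib,
    ← Finset.sum_sub_distrib]
  refine Finset.sum_congr rfl fun j _ => ?_
  simp only [← Complex.normSq_eq_norm_sq, Complex.normSq_apply, Pi.sub_apply, Complex.sub_re,
    Complex.sub_im, Complex.mul_re, Complex.mul_im, Complex.conj_re, Complex.conj_im,
    Complex.re_ofNat, Complex.im_ofNat]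
  ring

theorem herm_neg_left (z w : Fin n → ℂ) : herm (-z) w = -herm z w := by
  simp [herm, Finset.sum_neg_distrib]

theorem herm_conj (z w : Fin n → ℂ) : starRingEnd ℂ (herm z w) = herm w z := by
  simp [herm, map_sum, mul_comm]

/-- The fundamental solution with pole `[z, s]` in terms of `C_{-s}` and `P`. -/
theorem g_eq (s : ℝ) (η ξ : Heis n) :
    g (η.1, s) ξ = a0 n * ‖C s η ξ - P η ξ‖ ^ (-(n : ℝ)) := by
  -- `C - P` has real part `|z - z'|²`, and its imaginary part is minus the `t`-coordinate of `ξ⁻¹ ·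
  -- [z, s]`.
  have h : normSq (mul (inv ξ) ((η.1, s) : Heis n)).1 ^ 2 +
      (mul (inv ξ) ((η.1, s) : Heis n)).2 ^ 2 = ‖C s η ξ - P η ξ‖ ^ 2 := by
    have h1 : (mul (inv ξ) ((η.1, s) : Heis n)).1 = η.1 - ξ.1 := by
      simp only [mul, inv]; ring
    have h2 : (mul (inv ξ) ((η.1, s) : Heis n)).2 = -(ξ.2 - s - (P η ξ).im) := by
      simp only [mul, inv, herm_neg_left, P, ← herm_conj η.1 ξ.1]
      simp
      ring
    rw [h1, h2, ← Complex.normSq_eq_norm_sq, Complex.normSq_apply, Complex.sub_re, Complex.sub_im,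
      C_re, C_im, normSq_sub]
    simp only [P]
    ring
  rw [g, gE, h, ← Real.rpow_natCast, ← Real.rpow_mul (norm_nonneg _)]
  congr 2
  push_cast
  ring

theorem g_nonneg (η ξ : Heis n) : 0 ≤ g η ξ := by
  rw [show η = (η.1, η.2) from rfl, g_eq]
  exact mul_nonneg (a0_nonneg n) (Real.rpow_nonneg (norm_nonneg _) _)

theorem norm_exp_neg_mul_I (θ : ℝ) : ‖Complex.exp (-(θ * Complex.I))‖ = 1 := by
  have : -((θ : ℂ) * Complex.I) = ((-θ : ℝ) : ℂ) * Complex.I := by push_cast; ring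
  rw [this, Complex.norm_exp_ofReal_mul_I]

theorem normSq_rot (θ : ℝ) (ξ : Heis n) : normSq (rot θ ξ).1 = normSq ξ.1 := by
  simp [normSq, rot, Complex.norm_exp_ofReal_mul_I]

theorem C_rot (s θ : ℝ) (η ξ : Heis n) : C s η (rot θ ξ) = C s η ξ := by
  simp only [C, normSq_rot]; rfl

theorem P_rot (θ : ℝ) (η ξ : Heis n) :
    P η (rot θ ξ) = P η ξ * Complex.exp (-(θ * Complex.I)) := by
  simp only [P, herm, rot, map_mul, ← Complex.exp_conj, Complex.conj_I, Complex.conj_ofReal,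
    Finset.mul_sum, Finset.sum_mul]
  refine Finset.sum_congr rfl fun j _ => ?_
  ring_nf

theorem P_rot_left (θ s : ℝ) (η ξ : Heis n) :
    P ((rot θ η).1, s) ξ = P η ξ * Complex.exp (θ * Complex.I) := by
  simp only [P, herm, rot, Finset.mul_sum, Finset.sum_mul]
  refine Finset.sum_congr rfl fun j _ => ?_
  ring

theorem rot_neg_rot (θ : ℝ) (ξ : Heis n) : rot (-θ) (rot θ ξ) = ξ := by
  ext j
  · simp only [rot, ← mul_assoc, ← Complex.exp_add]
    simp
  · rfl

/-- Averaging in `ξ` thereby becomes averaging over poles on a circle, to which the fundamental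
solution property applies pole by pole. -/
theorem g_rot (s θ : ℝ) (η ξ : Heis n) :
    g (η.1, s) (rot θ ξ) = g (rot (-θ) (η.1, s)) ξ := by
  have h : rot (-θ) ((η.1, s) : Heis n) = (((rot (-θ) η).1, s) : Heis n) := rfl
  rw [g_eq, h, g_eq s ((rot (-θ) η).1, s) ξ, P_rot_left, P_rot, C_rot]
  have : C s ((rot (-θ) η).1, s) ξ = C s η ξ := by simp only [C, normSq_rot]
  rw [this]
  push_cast
  ring_nf

/-- Rotate `ξ` so that `P` becomes a nonnegative real number. -/
theorem exists_rot_P_eq_norm (η ξ : Heis n) : ∃ θ : ℝ, P η (rot θ ξ) = ‖P η ξ‖ := by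
  refine ⟨Complex.arg (P η ξ), ?_⟩
  rw [P_rot, Complex.exp_neg]
  nth_rewrite 1 [← Complex.norm_mul_exp_arg_mul_I (P η ξ)]
  rw [mul_assoc, mul_inv_cancel₀ (Complex.exp_ne_zero _), mul_one]

/-- After a rotation making `P` real, the difference of the two sides is `|z - e^{iθ} z'|²`. -/
theorem norm_P_le (η ξ : Heis n) : ‖P η ξ‖ ≤ normSq η.1 + normSq ξ.1 := by
  obtain ⟨θ, hθ⟩ := exists_rot_P_eq_norm η ξ
  have h := normSq_sub η.1 (rot θ ξ).1
  have h1 : (2 * herm η.1 (rot θ ξ).1).re = ‖P η ξ‖ := by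
    rw [show 2 * herm η.1 (rot θ ξ).1 = P η (rot θ ξ) from rfl, hθ, Complex.ofReal_re]
  rw [h1, normSq_rot] at h
  linarith [normSq_nonneg (η.1 - (rot θ ξ).1)]

/-- In `|P| ≤ Re C ≤ |C|`, equality throughout forces `t' = s` and `z = e^{iθ} z'` for some `θ`,
which is membership in the circle. This keeps the hypergeometric argument below 1. -/
theorem norm_P_lt_norm_C {s : ℝ} {η ξ : Heis n} (h : ξ ∉ circleThrough ((η.1, s) : Heis n)) :
    ‖P η ξ‖ < ‖C s η ξ‖ := by
  by_contra hle
  rw [not_lt] at hle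
  have hR := norm_P_le η ξ
  have hR0 : 0 ≤ normSq η.1 + normSq ξ.1 := add_nonneg (normSq_nonneg _) (normSq_nonneg _)
  have hC := norm_C_sq s η ξ
  have hsq : ‖C s η ξ‖ ^ 2 ≤ (normSq η.1 + normSq ξ.1) ^ 2 :=
    pow_le_pow_left₀ (norm_nonneg _) (hle.trans hR) 2
  have ht : ξ.2 = s := by
    have : (ξ.2 - s) ^ 2 = 0 := le_antisymm (by linarith) (sq_nonneg _)
    linarith [pow_eq_zero_iff (two_ne_zero) |>.mp this]
  have hRC : normSq η.1 + normSq ξ.1 ≤ ‖C s η ξ‖ := by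
    rw [← C_re s η ξ]; exact Complex.re_le_norm _
  obtain ⟨θ, hθ⟩ := exists_rot_P_eq_norm η ξ
  have h2 := normSq_sub η.1 (rot θ ξ).1
  have h1 : (2 * herm η.1 (rot θ ξ).1).re = ‖P η ξ‖ := by
    rw [show 2 * herm η.1 (rot θ ξ).1 = P η (rot θ ξ) from rfl, hθ, Complex.ofReal_re]
  rw [h1, normSq_rot] at h2
  have h0 : normSq (η.1 - (rot θ ξ).1) = 0 :=
    le_antisymm (by linarith) (normSq_nonneg _)
  rw [normSq_eq_zero, sub_eq_zero] at h0
  refine h ⟨-θ, ?_⟩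
  have : ((η.1, s) : Heis n) = rot θ ξ := Prod.ext h0 ht.symm
  simp only [this, rot_neg_rot]

/-- Factor `C - P e^{-iθ} = C (1 - w e^{-iθ})` with `w = P / C`, and take `a = n/2` in
`circleAverage_norm_one_sub_rpow`. -/
theorem H_eq_average {s : ℝ} {η ξ : Heis n} (h : ξ ∉ circleThrough ((η.1, s) : Heis n)) :
    H s η ξ = average (g (η.1, s)) ξ := by
  have hlt := norm_P_lt_norm_C h
  have hC0 : 0 < ‖C s η ξ‖ := (norm_nonneg _).trans_lt hlt
  have hC : C s η ξ ≠ 0 := norm_pos_iff.mp hC0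
  have hw : ‖P η ξ / C s η ξ‖ < 1 := by rw [norm_div, div_lt_one hC0]; exact hlt
  have key := circleAverage_norm_one_sub_rpow (a := (n : ℝ) / 2) hw
  have hg : ∀ θ : ℝ, g (η.1, s) (rot θ ξ) = a0 n * ‖C s η ξ‖ ^ (-(n : ℝ)) *
      ‖1 - P η ξ / C s η ξ * Complex.exp (-(θ * Complex.I))‖ ^ (-(2 * ((n : ℝ) / 2))) := by
    intro θ
    rw [g_eq, C_rot, P_rot, mul_assoc, mul_div_cancel₀ _ (two_ne_zero' ℝ),
      ← Real.mul_rpow (norm_nonneg _) (norm_nonneg _), ← norm_mul]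
    congr 3
    field_simp
  simp only [average, hg]
  rw [intervalIntegral.integral_const_mul, key, H, norm_div, div_pow, smul_eq_mul]
  have := Real.pi_pos.ne'
  field_simp

end Heisenberg

/-! ### Convergence and smoothness of series of `H` -/

/-- A smooth function on an open set agrees near each point with a globally smooth function of
compact support. -/
theorem ContDiffOn.exists_contDiff_hasCompactSupport {E : Type*} [NormedAddCommGroup E]
    [NormedSpace ℝ E] [FiniteDimensional ℝ E] {f : E → ℝ} {U : Set E} (hf : ContDiffOn ℝ ∞ f U)
    (hU : IsOpen U) {x : E} (hx : x ∈ U) :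
    ∃ F : E → ℝ, ContDiff ℝ ∞ F ∧ HasCompactSupport F ∧ F =ᶠ[𝓝 x] f := by
  obtain ⟨r, hr, hrU⟩ := Metric.nhds_basis_closedBall.mem_iff.mp (hU.mem_nhds hx)
  let b : ContDiffBump x := ⟨r / 2, r, half_pos hr, half_lt_self hr⟩
  refine ⟨fun y => b y * f y, ?_, ?_, ?_⟩
  · refine contDiff_iff_contDiffAt.mpr fun y => ?_
    by_cases hy : y ∈ tsupport b
    · rw [b.tsupport_eq] at hy
      exact b.contDiff.contDiffAt.mul (hf.contDiffAt (hU.mem_nhds (hrU hy)))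
    · refine contDiffAt_const (c := (0 : ℝ)) |>.congr_of_eventuallyEq ?_
      filter_upwards [notMem_tsupport_iff_eventuallyEq.mp hy] with z hz
      rw [hz, Pi.zero_apply, zero_mul]
  · exact b.hasCompactSupport.mul_right
  · filter_upwards [b.eventuallyEq_one] with y hy
    rw [hy, Pi.one_apply, one_mul]

theorem norm_iteratedFDeriv_prodMk_le {E G : Type*} [NormedAddCommGroup E] [NormedSpace ℝ E]
    [NormedAddCommGroup G] [NormedSpace ℝ G] {F : E × G → ℝ} (hF : ContDiff ℝ ∞ F) (c : G) (k : ℕ)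
    (x : E) :
    ‖iteratedFDeriv ℝ k (fun y => F (y, c)) x‖ ≤ ‖iteratedFDeriv ℝ k F (x, c)‖ := by
  have h1 : (fun y => F (y, c)) = (fun p => F (p + (0, c))) ∘ ContinuousLinearMap.inl ℝ E G := by
    ext y; simp
  have h2 : ContDiff ℝ ∞ fun p : E × G => F (p + (0, c)) := by fun_prop
  rw [h1, ContinuousLinearMap.iteratedFDeriv_comp_right _ h2 _ (mod_cast le_top),
    iteratedFDeriv_comp_add_right]
  refine (ContinuousMultilinearMap.norm_compContinuousLinearMap_le _ _).trans ?_
  have h3 : ∏ _i : Fin k, ‖ContinuousLinearMap.inl ℝ E G‖ ≤ 1 :=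
    Finset.prod_le_one (fun _ _ => norm_nonneg _) fun _ _ => ContinuousLinearMap.norm_inl_le_one ℝ E G
  refine (mul_le_of_le_one_right (norm_nonneg _) h3).trans ?_
  simp

/-- A weighted series of slices of a smooth compactly supported function is smooth. -/
theorem contDiff_tsum_slices {E G : Type*} [NormedAddCommGroup E] [NormedSpace ℝ E]
    [NormedAddCommGroup G] [NormedSpace ℝ G] {F : E × G → ℝ} (hF : ContDiff ℝ ∞ F)
    (hc : HasCompactSupport F) {a : ℕ → ℝ} (ha : Summable fun m => ‖a m‖) (c : ℕ → G) :
    ContDiff ℝ ∞ fun x => ∑' m, a m * F (x, c m) := by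
  -- Compact support bounds each derivative of `F` on all slices at once, so `∑ ‖a m‖` controls the
  -- differentiated series of every order.
  have hB : ∀ k : ℕ, ∃ B, ∀ p, ‖iteratedFDeriv ℝ k F p‖ ≤ B := fun k =>
    (hc.iteratedFDeriv k).exists_bound_of_continuous
      (hF.continuous_iteratedFDeriv (mod_cast le_top))
  choose B hB using hB
  have hs : ∀ m, ContDiff ℝ ∞ fun x => F (x, c m) := fun m => by fun_prop
  refine contDiff_tsum (N := ⊤) (v := fun k m => ‖a m‖ * B k) (fun m => contDiff_const.mul (hs m))
    (fun k _ => ha.mul_right _) fun k m x _ => ?_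
  have : iteratedFDeriv ℝ k (fun x => a m * F (x, c m)) x =
      a m • iteratedFDeriv ℝ k (fun x => F (x, c m)) x :=
    iteratedFDeriv_const_smul_apply' (a := a m) ((hs m).contDiffAt.of_le (mod_cast le_top))
  rw [this, norm_smul]
  exact mul_le_mul_of_nonneg_left ((norm_iteratedFDeriv_prodMk_le hF _ _ _).trans (hB k _))
    (norm_nonneg _)

theorem summable_abs_inv_pow {s : ℕ → ℝ} (hs : ∀ m : ℕ, (m : ℝ) ≤ |s m|) {n : ℕ} (hn : 2 ≤ n) :
    Summable fun m => |(s m)⁻¹| ^ n := by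
  refine Summable.of_norm_bounded_eventually (Real.summable_one_div_nat_pow.mpr hn) ?_
  rw [Nat.cofinite_eq_atTop]
  -- At `m = 0` the hypothesis gives no lower bound on `|s m|`, so the comparison with `m⁻ⁿ` starts
  -- at 1.
  filter_upwards [Filter.eventually_ge_atTop 1] with m hm
  have hm' : (0 : ℝ) < m := by exact_mod_cast hm
  rw [norm_pow, norm_abs_eq_norm, norm_inv, Real.norm_eq_abs, one_div, ← inv_pow]
  exact pow_le_pow_left₀ (by positivity) (inv_anti₀ hm' (hs m)) n

namespace Heisenberg

variable {n : ℕ}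

theorem snd_eq_of_mem_circleThrough {η ξ : Heis n} (h : ξ ∈ circleThrough η) : ξ.2 = η.2 := by
  obtain ⟨θ, rfl⟩ := h; rfl

@[fun_prop]
theorem contDiff_normSq : ContDiff ℝ ∞ fun z : Fin n → ℂ => normSq z := by
  unfold normSq
  exact ContDiff.sum fun j _ => (contDiff_apply ℝ ℂ j).norm_sq ℝ

@[fun_prop]
theorem contDiff_P (η : Heis n) : ContDiff ℝ ∞ fun ξ : Heis n => P η ξ := by
  unfold P herm
  refine contDiff_const.mul (ContDiff.sum fun j _ => contDiff_const.mul ?_)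
  exact Complex.conjCLE.contDiff.comp ((contDiff_apply ℝ ℂ j).comp contDiff_fst)

@[fun_prop]
theorem contDiff_C (s : ℝ) (η : Heis n) : ContDiff ℝ ∞ fun ξ : Heis n => C s η ξ := by
  unfold C
  refine ContDiff.add ?_ (contDiff_const.mul ?_)
  · exact Complex.ofRealCLM.contDiff.comp (contDiff_const.add (contDiff_normSq.comp contDiff_fst))
  · exact Complex.ofRealCLM.contDiff.comp (contDiff_snd.sub contDiff_const)

/-- The estimate is made under the circular average: `|C - P| ≥ |s| - |t'| - |P| ≥ |s| / 2` at every
rotation of `ξ`. -/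
theorem abs_H_le {s : ℝ} {η ξ : Heis n} (hs : s ≠ 0) (h : 2 * (|ξ.2| + ‖P η ξ‖) ≤ |s|) :
    |H s η ξ| ≤ a0 n * 2 ^ n * |s⁻¹| ^ n := by
  have hs0 : 0 < |s| := abs_pos.mpr hs
  have hP := norm_nonneg (P η ξ)
  have hξ : ξ ∉ circleThrough ((η.1, s) : Heis n) := by
    intro hmem
    have := snd_eq_of_mem_circleThrough hmem
    dsimp only at this
    rw [this] at h
    linarith
  have hB : ∀ θ : ℝ, ‖g ((η.1, s) : Heis n) (rot θ ξ)‖ ≤ a0 n * 2 ^ n * |s⁻¹| ^ n := by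
    intro θ
    rw [Real.norm_of_nonneg (g_nonneg _ _), g_eq, mul_assoc]
    refine mul_le_mul_of_nonneg_left ?_ (a0_nonneg n)
    have h1 : |s| / 2 ≤ ‖C s η (rot θ ξ) - P η (rot θ ξ)‖ := by
      have h2 := norm_sub_norm_le (C s η (rot θ ξ)) (P η (rot θ ξ))
      have h3 := Complex.abs_im_le_norm (C s η (rot θ ξ))
      rw [C_im] at h3
      have h4 : |s| - |ξ.2| ≤ |(rot θ ξ).2 - s| := by
        rw [abs_sub_comm]; exact abs_sub_abs_le_abs_sub s ξ.2
      have h5 : ‖P η (rot θ ξ)‖ = ‖P η ξ‖ := by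
        rw [P_rot, norm_mul, norm_exp_neg_mul_I, mul_one]
      linarith
    calc ‖C s η (rot θ ξ) - P η (rot θ ξ)‖ ^ (-(n : ℝ)) ≤ (|s| / 2) ^ (-(n : ℝ)) :=
          Real.rpow_le_rpow_of_nonpos (by positivity) h1 (by simp)
      _ = 2 ^ n * |s⁻¹| ^ n := by
          rw [Real.rpow_neg (by positivity), Real.rpow_natCast, abs_inv, div_pow, inv_div, inv_pow]
          rfl
  rw [H_eq_average hξ, average, smul_eq_mul, abs_mul, abs_of_pos (by positivity)]
  have := intervalIntegral.norm_integral_le_of_norm_le_const (a := 0) (b := 2 * Real.pi)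
    (f := fun θ => g ((η.1, s) : Heis n) (rot θ ξ)) fun θ _ => hB θ
  rw [Real.norm_eq_abs, sub_zero, abs_of_pos Real.two_pi_pos] at this
  rw [inv_mul_le_iff₀ Real.two_pi_pos]
  linarith

theorem continuous_abs_snd_add_norm_P (η : Heis n) :
    Continuous fun ξ : Heis n => 2 * (|ξ.2| + ‖P η ξ‖) := by
  have := (contDiff_P η).continuous
  fun_prop

theorem tendsto_abs_atTop {s : ℕ → ℝ} (hs : ∀ m : ℕ, (m : ℝ) ≤ |s m|) :
    Filter.Tendsto (fun m => |s m|) Filter.atTop Filter.atTop :=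
  Filter.tendsto_atTop_mono hs tendsto_natCast_atTop_atTop

theorem eventually_abs_H_le {s : ℕ → ℝ} (hs : ∀ m : ℕ, (m : ℝ) ≤ |s m|) (η : Heis n)
    {K : Set (Heis n)} (hK : IsCompact K) :
    ∀ᶠ m in Filter.atTop, ∀ ξ ∈ K, ‖H (s m) η ξ‖ ≤ a0 n * 2 ^ n * |(s m)⁻¹| ^ n := by
  obtain ⟨B, hB⟩ := hK.exists_bound_of_continuousOn (continuous_abs_snd_add_norm_P η).continuousOn
  filter_upwards [(tendsto_abs_atTop hs).eventually_ge_atTop B,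
    (tendsto_abs_atTop hs).eventually_gt_atTop 0] with m hm hm0 ξ hξ
  exact abs_H_le (abs_pos.mp hm0) ((le_abs_self _).trans ((hB ξ hξ).trans hm))

theorem summableLocallyUniformlyOn_H {s : ℕ → ℝ} (hs : ∀ m : ℕ, (m : ℝ) ≤ |s m|) (hn : 2 ≤ n)
    (η : Heis n) {U : Set (Heis n)} (hU : IsOpen U) :
    SummableLocallyUniformlyOn (fun (m : ℕ) ξ => H (s m) η ξ) U := by
  refine SummableLocallyUniformlyOn.of_locally_bounded_eventually hU fun K _ hK =>
    ⟨_, (summable_abs_inv_pow hs hn).mul_left (a0 n * 2 ^ n), ?_⟩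
  rw [Nat.cofinite_eq_atTop]
  exact eventually_abs_H_le hs η hK

theorem summable_H {s : ℕ → ℝ} (hs : ∀ m : ℕ, (m : ℝ) ≤ |s m|) (hn : 2 ≤ n) (η ξ : Heis n) :
    Summable fun m => H (s m) η ξ := by
  refine Summable.of_norm_bounded_eventually
    ((summable_abs_inv_pow hs hn).mul_left (a0 n * 2 ^ n)) ?_
  rw [Nat.cofinite_eq_atTop]
  filter_upwards [eventually_abs_H_le hs η (isCompact_singleton (x := ξ))] with m hm
  exact hm ξ rfl

/-- The profile of `H`: `H s η ξ = profile n (‖P‖², ‖C‖²)`. -/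
noncomputable def profile (n : ℕ) (x : ℝ × ℝ) : ℝ :=
  a0 n * x.2 ^ (-(n : ℝ) / 2) * ordinaryHypergeometric ((n : ℝ) / 2) ((n : ℝ) / 2) (1 : ℝ)
    (x.1 / x.2)

theorem contDiffAt_ordinaryHypergeometric {a b c x : ℝ} (hx : |x| < 1)
    (habc : ∀ k : ℕ, (k : ℝ) ≠ -a ∧ (k : ℝ) ≠ -b ∧ (k : ℝ) ≠ -c) :
    ContDiffAt ℝ ∞ (ordinaryHypergeometric a b c) x := by
  have hr := ordinaryHypergeometricSeries_radius_eq_one ℝ a b c habc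
  have h := (ordinaryHypergeometricSeries ℝ a b c).hasFPowerSeriesOnBall (by rw [hr]; simp)
  rw [hr] at h
  refine (h.analyticAt_of_mem ?_).contDiffAt
  rw [Metric.mem_eball, edist_zero_right, ← ofReal_norm]
  exact ENNReal.ofReal_lt_one.mpr hx

theorem contDiffAt_profile (hn : 0 < n) {x : ℝ × ℝ} (h0 : 0 ≤ x.1) (h : x.1 < x.2) :
    ContDiffAt ℝ ∞ (profile n) x := by
  have hpos : 0 < x.2 := h0.trans_lt h
  have hn' : (0 : ℝ) < n := by exact_mod_cast hn
  refine (contDiffAt_const.mul (contDiffAt_snd.rpow_const_of_ne hpos.ne')).mul ?_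
  refine ContDiffAt.comp (g := ordinaryHypergeometric ((n : ℝ) / 2) ((n : ℝ) / 2) (1 : ℝ))
    (f := fun x : ℝ × ℝ => x.1 / x.2) x (contDiffAt_ordinaryHypergeometric ?_ fun k => ?_)
    (contDiffAt_fst.div contDiffAt_snd hpos.ne')
  · rw [abs_of_nonneg (by positivity), div_lt_one hpos]; exact h
  · have hk : (0 : ℝ) ≤ k := Nat.cast_nonneg k
    refine ⟨?_, ?_, ?_⟩ <;> intro h <;> linarith

theorem H_eq_profile (s : ℝ) (η ξ : Heis n) :
    H s η ξ = profile n (‖P η ξ‖ ^ 2, ‖C s η ξ‖ ^ 2) := by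
  simp only [H, profile]
  rw [← Real.rpow_natCast ‖C s η ξ‖ 2, ← Real.rpow_mul (norm_nonneg _)]
  congr 3
  push_cast
  ring

/-- The hypergeometric factor depends on `p / q` only, so homogeneity comes from the power of `q`.
With `σ = 1/s` this extracts the decay `|s|⁻ⁿ` of `H`. -/
theorem profile_scale {σ : ℝ} (hσ : σ ≠ 0) {p q : ℝ} (hq : 0 ≤ q) :
    profile n (p, q) = |σ| ^ n * profile n (σ ^ 2 * p, σ ^ 2 * q) := by
  simp only [profile]
  rw [mul_div_mul_left _ _ (pow_ne_zero 2 hσ), Real.mul_rpow (sq_nonneg σ) hq, ← sq_abs σ,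
    ← Real.rpow_natCast |σ| 2, ← Real.rpow_mul (abs_nonneg σ)]
  have h1 : ((2 : ℕ) : ℝ) * (-(n : ℝ) / 2) = -(n : ℝ) := by push_cast; ring
  have h2 : |σ| ^ n * |σ| ^ (-(n : ℝ)) = 1 := by
    rw [Real.rpow_neg (abs_nonneg σ), Real.rpow_natCast, mul_inv_cancel₀]
    exact pow_ne_zero n (abs_ne_zero.mpr hσ)
  rw [h1]
  linear_combination (-(a0 n) * q ^ (-(n : ℝ) / 2) *
    ordinaryHypergeometric ((n : ℝ) / 2) ((n : ℝ) / 2) (1 : ℝ) (p / q)) * h2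

theorem contDiffAt_H (hn : 0 < n) {s : ℝ} {η ξ : Heis n}
    (h : ξ ∉ circleThrough ((η.1, s) : Heis n)) : ContDiffAt ℝ ∞ (H s η) ξ := by
  have h1 : H s η = profile n ∘ fun ξ => (‖P η ξ‖ ^ 2, ‖C s η ξ‖ ^ 2) :=
    funext fun ξ => H_eq_profile s η ξ
  rw [h1]
  refine ContDiffAt.comp ξ (contDiffAt_profile hn (sq_nonneg _) ?_) ?_
  · exact pow_lt_pow_left₀ (norm_P_lt_norm_C h) (norm_nonneg _) two_ne_zero
  · exact (((contDiff_P η).norm_sq ℝ).prodMk ((contDiff_C s η).norm_sq ℝ)).contDiffAt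

/-- `H` in the variable `σ = 1/s`, stripped of the factor `|σ|ⁿ`; it is smooth across `σ = 0`. -/
noncomputable def rescaledH (η : Heis n) (x : Heis n × ℝ) : ℝ :=
  profile n (x.2 ^ 2 * ‖P η x.1‖ ^ 2,
    (x.2 * (normSq η.1 + normSq x.1.1)) ^ 2 + (x.2 * x.1.2 - 1) ^ 2)

theorem H_eq_rescaledH {s : ℝ} (hs : s ≠ 0) (η ξ : Heis n) :
    H s η ξ = |s⁻¹| ^ n * rescaledH η (ξ, s⁻¹) := by
  rw [H_eq_profile, profile_scale (inv_ne_zero hs) (sq_nonneg _), rescaledH, norm_C_sq]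
  congr 3
  field_simp

/-- Near `(ξ₀, 0)` the function `rescaledH` is smooth and can be replaced by a compactly supported
`F`. As `1 / s m → 0`, the tail of the series is a weighted sum of slices of `F`, and no derivative
of the hypergeometric function has to be estimated. The finitely many other terms are smooth by the
hypothesis on the circles. -/
theorem contDiffAt_tsum_H (hn : 2 ≤ n) {s : ℕ → ℝ} (hs : ∀ m : ℕ, (m : ℝ) ≤ |s m|) {η ξ₀ : Heis n}
    (h : ∀ m, ξ₀ ∉ circleThrough ((η.1, s m) : Heis n)) :
    ContDiffAt ℝ ∞ (fun ξ => ∑' m, H (s m) η ξ) ξ₀ := by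
  have hP := contDiff_P η
  have hN : ContDiff ℝ ∞ fun x : Heis n × ℝ => normSq x.1.1 :=
    contDiff_normSq.comp (contDiff_fst.comp contDiff_fst)
  have hP2 : ContDiff ℝ ∞ fun x : Heis n × ℝ => x.2 ^ 2 * ‖P η x.1‖ ^ 2 :=
    (contDiff_snd.pow 2).mul ((hP.comp contDiff_fst).norm_sq ℝ)
  have hQ : ContDiff ℝ ∞ fun x : Heis n × ℝ =>
      (x.2 * (normSq η.1 + normSq x.1.1)) ^ 2 + (x.2 * x.1.2 - 1) ^ 2 := by fun_prop
  -- On `U` the hypergeometric argument is below 1; at `σ = 0` the condition reads `0 < 1`.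
  set U : Set (Heis n × ℝ) := {x | x.2 ^ 2 * ‖P η x.1‖ ^ 2 <
    (x.2 * (normSq η.1 + normSq x.1.1)) ^ 2 + (x.2 * x.1.2 - 1) ^ 2} with hUdef
  have hU : IsOpen U := isOpen_lt hP2.continuous hQ.continuous
  have hcd : ContDiffOn ℝ ∞ (rescaledH η) U := fun x hx =>
    (ContDiffAt.comp (g := profile n) (f := fun x : Heis n × ℝ => (x.2 ^ 2 * ‖P η x.1‖ ^ 2,
      (x.2 * (normSq η.1 + normSq x.1.1)) ^ 2 + (x.2 * x.1.2 - 1) ^ 2)) x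
      (contDiffAt_profile (by omega) (by positivity) hx)
      (hP2.prodMk hQ).contDiffAt).contDiffWithinAt
  obtain ⟨F, hF, hFc, hFe⟩ := hcd.exists_contDiff_hasCompactSupport hU
    (x := (ξ₀, 0)) (by simp [hUdef])
  rw [nhds_prod_eq] at hFe
  obtain ⟨V, hV, W, hW, hVW⟩ := Filter.eventually_prod_iff.mp hFe
  have hlim : Filter.Tendsto (fun m => (s m)⁻¹) Filter.atTop (𝓝 0) := by
    rw [tendsto_zero_iff_abs_tendsto_zero]
    simp only [Function.comp_def, abs_inv]
    exact (tendsto_abs_atTop hs).inv_tendsto_atTop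
  obtain ⟨M, hM⟩ := Filter.eventually_atTop.mp
    ((hlim.eventually hW).and ((tendsto_abs_atTop hs).eventually_gt_atTop 0))
  have htail : ContDiff ℝ ∞ fun ξ => ∑' m, |(s (m + M))⁻¹| ^ n * F (ξ, (s (m + M))⁻¹) := by
    refine contDiff_tsum_slices hF hFc (a := fun m => |(s (m + M))⁻¹| ^ n) ?_ _
    have := ((summable_nat_add_iff M).mpr (summable_abs_inv_pow hs hn)).norm
    exact this
  have hhead : ContDiffAt ℝ ∞ (fun ξ => ∑ m ∈ Finset.range M, H (s m) η ξ) ξ₀ :=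
    ContDiffAt.sum fun m _ => contDiffAt_H (by omega) (h m)
  refine (hhead.add htail.contDiffAt).congr_of_eventuallyEq ?_
  filter_upwards [hV] with ξ hξ
  rw [← (summable_H hs hn η ξ).sum_add_tsum_nat_add M]
  congr 1
  refine tsum_congr fun m => ?_
  obtain ⟨h1, h2⟩ := hM (m + M) (by omega)
  rw [H_eq_rescaledH (abs_pos.mp h2), hVW hξ h1]

end Heisenberg

/-! ### Integrals evaluated by Gamma functions -/

section GammaIntegrals

open MeasureTheory Real Set
open scoped ENNReal

/-- If `∫ exp (-λ h) = (π / λ) ^ d` for all `λ > 0`, then the integral of `(b + h) ^ (-s)` is a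
quotient of Gamma functions. -/
theorem lintegral_rpow_neg_of_gaussian {α : Type*} [MeasurableSpace α] {μ : Measure α} [SFinite μ]
    {h : α → ℝ} (hm : Measurable h) (h0 : ∀ x, 0 ≤ h x) {d : ℝ}
    (hg : ∀ l : ℝ, 0 < l → ∫⁻ x, ENNReal.ofReal (exp (-(l * h x))) ∂μ =
      ENNReal.ofReal ((π / l) ^ d))
    {b s : ℝ} (hb : 0 < b) (hd : 0 ≤ d) (hs : d < s) :
    ∫⁻ x, ENNReal.ofReal ((b + h x) ^ (-s)) ∂μ =
      ENNReal.ofReal (π ^ d * Gamma (s - d) / Gamma s * b ^ (d - s)) := by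
  have hs0 : 0 < s := hd.trans_lt hs
  have hgam : ∀ {s r : ℝ}, 0 < s → 0 < r →
      ∫⁻ l in Ioi (0 : ℝ), ENNReal.ofReal (l ^ (s - 1) * exp (-(r * l))) =
        ENNReal.ofReal ((1 / r) ^ s * Gamma s) := by
    intro s r hs0 hr
    rw [← integral_rpow_mul_exp_neg_mul_Ioi hs0 hr, ofReal_integral_eq_lintegral_ofReal]
    · have := integrableOn_rpow_mul_exp_neg_mul_rpow (p := 1) (s := s - 1) (b := r) (by linarith)
        one_pos hr
      simp only [rpow_one, neg_mul] at this
      exact this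
    · refine (ae_restrict_iff' measurableSet_Ioi).mpr (Filter.Eventually.of_forall fun l hl => ?_)
      have : (0 : ℝ) < l := hl
      positivity
  have hΓ : 0 < Gamma s := Gamma_pos_of_pos hs0
  -- Write `(b + h)^(-s)` as `Γ(s)⁻¹ ∫ l^(s-1) e^{-(b+h)l} dl`; Tonelli then brings in the Gaussian
  -- integral of `h`.
  have h1 : ∀ x, ENNReal.ofReal ((b + h x) ^ (-s)) = ENNReal.ofReal (Gamma s)⁻¹ *
      ∫⁻ l in Ioi (0 : ℝ), ENNReal.ofReal (l ^ (s - 1) * exp (-((b + h x) * l))) := by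
    intro x
    have hx : 0 < b + h x := add_pos_of_pos_of_nonneg hb (h0 x)
    rw [hgam hs0 hx, ← ENNReal.ofReal_mul (by positivity)]
    congr 1
    rw [one_div, inv_rpow hx.le, rpow_neg hx.le]
    field_simp
  simp only [h1]
  have hmeas : Measurable fun p : α × ℝ =>
      ENNReal.ofReal (p.2 ^ (s - 1) * exp (-((b + h p.1) * p.2))) := by fun_prop
  rw [lintegral_const_mul _ hmeas.lintegral_prod_right', lintegral_lintegral_swap hmeas.aemeasurable]
  have h2 : ∀ l ∈ Ioi (0 : ℝ), ∫⁻ x, ENNReal.ofReal (l ^ (s - 1) * exp (-((b + h x) * l))) ∂μ =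
      ENNReal.ofReal (π ^ d) * ENNReal.ofReal (l ^ (s - d - 1) * exp (-(b * l))) := by
    intro l hl
    have hl' : (0 : ℝ) < l := hl
    have : ∀ x, ENNReal.ofReal (l ^ (s - 1) * exp (-((b + h x) * l))) =
        ENNReal.ofReal (l ^ (s - 1) * exp (-(b * l))) * ENNReal.ofReal (exp (-(l * h x))) := by
      intro x
      rw [← ENNReal.ofReal_mul (by positivity), mul_assoc, ← exp_add]
      ring_nf
    simp only [this]
    rw [lintegral_const_mul _ (by fun_prop), hg l hl', ← ENNReal.ofReal_mul (by positivity),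
      ← ENNReal.ofReal_mul (by positivity)]
    congr 1
    rw [div_rpow pi_pos.le hl'.le, show s - d - 1 = s - 1 - d by ring, rpow_sub hl' (s - 1) d]
    ring
  rw [setLIntegral_congr_fun measurableSet_Ioi h2, lintegral_const_mul _ (by fun_prop),
    hgam (sub_pos.mpr hs) hb, ← ENNReal.ofReal_mul (by positivity),
    ← ENNReal.ofReal_mul (by positivity)]
  congr 1
  rw [one_div, inv_rpow hb.le, ← rpow_neg hb.le, neg_sub]
  ring

theorem lintegral_exp_neg_mul_sq {l : ℝ} (hl : 0 < l) :
    ∫⁻ t : ℝ, ENNReal.ofReal (exp (-(l * t ^ 2))) = ENNReal.ofReal ((π / l) ^ (1 / 2 : ℝ)) := by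
  simp only [← neg_mul]
  rw [← ofReal_integral_eq_lintegral_ofReal (integrable_exp_neg_mul_sq hl)
    (Filter.Eventually.of_forall fun _ => by positivity), integral_gaussian, ← sqrt_eq_rpow]

theorem lintegral_add_sq_rpow_neg {b s : ℝ} (hb : 0 < b) (hs : 1 / 2 < s) :
    ∫⁻ t : ℝ, ENNReal.ofReal ((b + t ^ 2) ^ (-s)) =
      ENNReal.ofReal (π ^ (1 / 2 : ℝ) * Gamma (s - 1 / 2) / Gamma s * b ^ (1 / 2 - s)) :=
  lintegral_rpow_neg_of_gaussian (by fun_prop) (fun t => sq_nonneg t)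
    (fun _ hl => lintegral_exp_neg_mul_sq hl) hb (by norm_num) hs

theorem lintegral_exp_neg_mul_normSq {n : ℕ} {l : ℝ} (hl : 0 < l) :
    ∫⁻ z : Fin n → ℂ, ENNReal.ofReal (exp (-(l * Heisenberg.normSq z))) =
      ENNReal.ofReal ((π / l) ^ (n : ℝ)) := by
  have h1 : ∀ z : Fin n → ℂ, exp (-(l * Heisenberg.normSq z)) = ∏ j, exp (-l * ‖z j‖ ^ 2) := by
    intro z
    rw [← exp_sum, Heisenberg.normSq, Finset.mul_sum, ← Finset.sum_neg_distrib]
    simp only [neg_mul]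
  have hc : ∫ v : ℂ, exp (-l * ‖v‖ ^ 2) = π / l := by
    rw [GaussianFourier.integral_rexp_neg_mul_sq_norm (V := ℂ) hl, Complex.finrank_real_complex]
    norm_num
  have hint : Integrable fun v : ℂ => exp (-l * ‖v‖ ^ 2) := by
    by_contra hni
    rw [integral_undef hni] at hc
    exact (by positivity : π / l ≠ 0) hc.symm
  simp only [h1]
  have hprod : Integrable fun z : Fin n → ℂ => ∏ j, exp (-l * ‖z j‖ ^ 2) :=
    Integrable.fintype_prod fun _ => hint
  rw [← ofReal_integral_eq_lintegral_ofReal hprod (Filter.Eventually.of_forall fun _ => by positivity),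
    integral_fintype_prod_volume_eq_prod fun _ (v : ℂ) => exp (-l * ‖v‖ ^ 2)]
  simp only [hc, Finset.prod_const, Finset.card_univ, Fintype.card_fin, rpow_natCast]

theorem lintegral_one_add_normSq {n : ℕ} {s : ℝ} (hs : n < s) :
    ∫⁻ z : Fin n → ℂ, ENNReal.ofReal ((1 + Heisenberg.normSq z) ^ (-s)) =
      ENNReal.ofReal (π ^ n * Gamma (s - n) / Gamma s) := by
  rw [lintegral_rpow_neg_of_gaussian Heisenberg.contDiff_normSq.continuous.measurable
    Heisenberg.normSq_nonneg (fun _ hl => lintegral_exp_neg_mul_normSq hl) one_pos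
    (Nat.cast_nonneg n) hs, one_rpow, mul_one, rpow_natCast]

end GammaIntegrals

/-! ### Mass of the kernel and integrability of the fundamental solution -/

namespace Heisenberg

open MeasureTheory Real Set
open scoped ENNReal

variable {n : ℕ}

/-- The approximate identity `L₀ |A_ε|⁻ⁿ`, up to scaling, for the regularised fundamental
solution. -/
noncomputable def kernel (ξ : Heis n) : ℝ :=
  a0 n * n ^ 2 * ((1 + normSq ξ.1) ^ 2 + ξ.2 ^ 2) ^ (-((n : ℝ) / 2 + 1))

theorem kernel_nonneg (ξ : Heis n) : 0 ≤ kernel ξ := by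
  have := a0_nonneg n
  have := normSq_nonneg ξ.1
  unfold kernel; positivity

theorem kernel_base_pos (ξ : Heis n) : 0 < (1 + normSq ξ.1) ^ 2 + ξ.2 ^ 2 := by
  have := normSq_nonneg ξ.1; positivity

theorem continuous_kernel : Continuous (kernel (n := n)) := by
  have h : Continuous fun ξ : Heis n => (1 + normSq ξ.1) ^ 2 + ξ.2 ^ 2 := by
    have := (contDiff_normSq (n := n)).continuous
    fun_prop
  exact continuous_const.mul (h.rpow_const fun ξ => Or.inl (kernel_base_pos ξ).ne')

/-- This fixes the value of `a0`. Integrating in `t` and then in `z` leaves a quotient of Gamma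
values, which Legendre duplication at `n/2` reduces to 1. -/
theorem lintegral_kernel (hn : 0 < n) : ∫⁻ ξ : Heis n, ENNReal.ofReal (kernel ξ) = 1 := by
  have hn' : (0 : ℝ) < n := by exact_mod_cast hn
  have ha := a0_nonneg n
  rw [Measure.volume_eq_prod,
    lintegral_prod _ continuous_kernel.measurable.ennreal_ofReal.aemeasurable]
  have h1 : ∀ z : Fin n → ℂ, ∫⁻ t : ℝ, ENNReal.ofReal (kernel (z, t)) =
      ENNReal.ofReal (a0 n * n ^ 2 * (π ^ (1 / 2 : ℝ) * Gamma ((n : ℝ) / 2 + 1 - 1 / 2) /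
        Gamma ((n : ℝ) / 2 + 1))) * ENNReal.ofReal ((1 + normSq z) ^ (-((n : ℝ) + 1))) := by
    intro z
    have hz : 0 < 1 + normSq z := by have := normSq_nonneg z; positivity
    have hk : ∀ t : ℝ, ENNReal.ofReal (kernel (z, t)) = ENNReal.ofReal (a0 n * n ^ 2) *
        ENNReal.ofReal (((1 + normSq z) ^ 2 + t ^ 2) ^ (-((n : ℝ) / 2 + 1))) :=
      fun t => ENNReal.ofReal_mul (by positivity)
    simp only [hk]
    rw [lintegral_const_mul _ (by fun_prop), lintegral_add_sq_rpow_neg (by positivity) (by linarith),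
      ← ENNReal.ofReal_mul (show 0 ≤ a0 n * (n : ℝ) ^ 2 by positivity),
      ← ENNReal.ofReal_mul' (rpow_nonneg hz.le _)]
    congr 1
    rw [← rpow_natCast (1 + normSq z) 2, ← rpow_mul hz.le,
      show ((2 : ℕ) : ℝ) * (1 / 2 - ((n : ℝ) / 2 + 1)) = -((n : ℝ) + 1) by push_cast; ring]
    ring
  simp only [h1]
  have hm : Measurable fun z : Fin n → ℂ => normSq z := contDiff_normSq.continuous.measurable
  rw [lintegral_const_mul _ (by fun_prop), lintegral_one_add_normSq (by linarith),
    ← ENNReal.ofReal_mul' (by rw [add_sub_cancel_left]; positivity), ENNReal.ofReal_eq_one,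
    add_sub_cancel_left, Gamma_one, Gamma_add_one hn'.ne', Gamma_add_one (by positivity : (n:ℝ) / 2 ≠ 0),
    show (n : ℝ) / 2 + 1 - 1 / 2 = n / 2 + 1 / 2 by ring]
  have hdup := Gamma_mul_Gamma_add_half ((n : ℝ) / 2)
  rw [mul_div_cancel₀ _ (two_ne_zero' ℝ), sqrt_eq_rpow] at hdup
  have hG1 : 0 < Gamma ((n : ℝ) / 2) := Gamma_pos_of_pos (by positivity)
  have hG2 : 0 < Gamma (n : ℝ) := Gamma_pos_of_pos hn'
  have hG3 : Gamma ((n : ℝ) / 2 + 1 / 2) =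
      Gamma n * 2 ^ (1 - (n : ℝ)) * π ^ (1 / 2 : ℝ) / Gamma ((n : ℝ) / 2) := by
    rw [← hdup]; field_simp
  have hpi : π ^ (1 / 2 : ℝ) * π ^ (1 / 2 : ℝ) = π := by
    rw [← rpow_add pi_pos]; norm_num
  have h2 : (2 : ℝ) ^ (1 - (n : ℝ)) = 2 / 2 ^ n := by
    rw [rpow_sub two_pos, rpow_one, rpow_natCast]
  have h3 : (2 : ℝ) ^ ((n : ℤ) - 2) = 2 ^ n / 4 := by
    rw [zpow_sub₀ two_ne_zero, zpow_natCast]; norm_num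
  rw [hG3, a0, h2, h3, pow_succ π n]
  have hpi0 := pi_pos.ne'
  field_simp
  linear_combination 4 * hpi

theorem integrable_kernel (hn : 0 < n) : Integrable (kernel (n := n)) := by
  refine ⟨continuous_kernel.aestronglyMeasurable, ?_⟩
  rw [hasFiniteIntegral_iff_ofReal (Filter.Eventually.of_forall kernel_nonneg), lintegral_kernel hn]
  exact ENNReal.one_lt_top

theorem integral_kernel (hn : 0 < n) : ∫ ξ : Heis n, kernel ξ = 1 := by
  rw [integral_eq_lintegral_of_nonneg_ae (Filter.Eventually.of_forall kernel_nonneg)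
    continuous_kernel.aestronglyMeasurable, lintegral_kernel hn, ENNReal.toReal_one]

theorem continuous_mul_inv : Continuous fun p : Heis n × Heis n => mul (inv p.2) p.1 := by
  have h : Continuous fun p : Heis n × Heis n => herm (-p.2.1) p.1.1 := by
    unfold herm
    refine continuous_finsetSum _ fun j _ => ?_
    refine ((continuous_apply j).comp (continuous_fst.comp continuous_snd).neg).mul ?_
    exact Complex.continuous_conj.comp ((continuous_apply j).comp (continuous_fst.comp continuous_fst))
  refine Continuous.prodMk ?_ ?_
  · exact (continuous_fst.comp continuous_snd).neg.add (continuous_fst.comp continuous_fst)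
  · exact ((continuous_snd.comp continuous_snd).neg.add (continuous_snd.comp continuous_fst)).add
      (continuous_const.mul (Complex.continuous_im.comp h))

theorem measurable_gE : Measurable (gE (n := n)) := by
  have h : Measurable fun ξ : Heis n => normSq ξ.1 :=
    (contDiff_normSq.continuous.measurable).comp measurable_fst
  exact ((((h.pow_const 2).add (measurable_snd.pow_const 2))).pow_const _).const_mul _

theorem measurable_g_uncurry : Measurable fun p : Heis n × Heis n => g p.1 p.2 := by
  have h := measurable_gE.comp (continuous_mul_inv (n := n)).measurable
  unfold g
  exact h

theorem measurable_g (η : Heis n) : Measurable (g η) := by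
  have h : Measurable fun ξ : Heis n => (η, ξ) := measurable_prodMk_left
  have h2 := measurable_g_uncurry.comp h
  exact h2

theorem norm_sq_le_normSq (z : Fin n → ℂ) : ‖z‖ ^ 2 ≤ normSq z := by
  have h : ‖z‖ ≤ √(normSq z) := by
    refine (pi_norm_le_iff_of_nonneg (sqrt_nonneg _)).mpr fun j => ?_
    refine le_sqrt_of_sq_le ?_
    exact Finset.single_le_sum (f := fun j => ‖z j‖ ^ 2) (fun _ _ => by positivity)
      (Finset.mem_univ j)
  calc ‖z‖ ^ 2 ≤ √(normSq z) ^ 2 := pow_le_pow_left₀ (norm_nonneg _) h 2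
    _ = normSq z := sq_sqrt (normSq_nonneg z)

/-- Integrating out `t` leaves a multiple of `|η.1 - z|^{-(2n-2)}` in the Euclidean norm, which
dominates the sup norm of `Fin n → ℂ`. The singularity is weaker than the real dimension `2n`, and
`c` does not depend on the pole. -/
theorem lintegral_g_snd (hn : 2 ≤ n) : ∃ c : ℝ≥0∞, c ≠ ⊤ ∧ ∀ (η : Heis n) (z : Fin n → ℂ),
    η.1 ≠ z → ∫⁻ t : ℝ, ENNReal.ofReal (g η (z, t)) ≤
      c * ENNReal.ofReal ((‖η.1 - z‖ ^ (2 * n - 2))⁻¹) := by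
  have hn' : (2 : ℝ) ≤ n := by exact_mod_cast hn
  refine ⟨ENNReal.ofReal (a0 n * (π ^ (1 / 2 : ℝ) * Gamma ((n : ℝ) / 2 - 1 / 2) /
    Gamma ((n : ℝ) / 2))), ENNReal.ofReal_ne_top, fun η z hz => ?_⟩
  have ha := a0_nonneg n
  have hpos : 0 < ‖η.1 - z‖ := norm_pos_iff.mpr (sub_ne_zero.mpr hz)
  have hN : ‖η.1 - z‖ ^ 2 ≤ normSq (η.1 - z) := norm_sq_le_normSq _
  have hN0 : 0 < normSq (η.1 - z) := lt_of_lt_of_le (by positivity) hN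
  have h1 : ∀ t : ℝ, ENNReal.ofReal (g η (z, t)) = ENNReal.ofReal (a0 n) *
      (fun t => ENNReal.ofReal ((normSq (η.1 - z) ^ 2 + t ^ 2) ^ (-((n : ℝ) / 2))))
        ((η.2 + 2 * (herm (-z) η.1).im) - t) := by
    intro t
    dsimp only
    rw [← ENNReal.ofReal_mul ha, g, gE]
    simp only [mul, inv]
    rw [neg_div, neg_add_eq_sub]
    ring_nf
  simp only [h1]
  rw [lintegral_const_mul _ (by fun_prop), lintegral_sub_left_eq_self
    (fun t : ℝ => ENNReal.ofReal ((normSq (η.1 - z) ^ 2 + t ^ 2) ^ (-((n : ℝ) / 2)))),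
    lintegral_add_sq_rpow_neg (by positivity) (by linarith), ← ENNReal.ofReal_mul ha,
    ← ENNReal.ofReal_mul' (by positivity)]
  refine ENNReal.ofReal_le_ofReal ?_
  rw [← mul_assoc]
  have hG1 : 0 < Gamma ((n : ℝ) / 2) := Gamma_pos_of_pos (by positivity)
  have hG2 : 0 < Gamma ((n : ℝ) / 2 - 1 / 2) := Gamma_pos_of_pos (by linarith)
  refine mul_le_mul_of_nonneg_left ?_ (by positivity)
  rw [← rpow_natCast (normSq (η.1 - z)) 2, ← rpow_mul hN0.le,
    show ((2 : ℕ) : ℝ) * (1 / 2 - (n : ℝ) / 2) = -((n - 1 : ℕ) : ℝ) by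
      push_cast [Nat.cast_sub (show 1 ≤ n by omega)]; ring,
    rpow_neg hN0.le, rpow_natCast, show 2 * n - 2 = 2 * (n - 1) by omega, pow_mul]
  exact inv_anti₀ (by positivity) (pow_le_pow_left₀ (by positivity) hN _)

/-- In polar coordinates the radial integrand is `y^(2n-1) y^{-(2n-2)} = y`. -/
theorem lintegral_inv_norm_pow_lt_top (hn : 2 ≤ n) (r : ℝ) :
    ∫⁻ z in Metric.ball (0 : Fin n → ℂ) r, ENNReal.ofReal ((‖z‖ ^ (2 * n - 2))⁻¹) < ⊤ := by
  have : Nonempty (Fin n) := ⟨⟨0, by omega⟩⟩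
  have hdim : Module.finrank ℝ (Fin n → ℂ) = 2 * n := by
    rw [Module.finrank_pi_fintype]; simp [Complex.finrank_real_complex, mul_comm]
  have hI : IntegrableOn (fun z : Fin n → ℂ => (‖z‖ ^ (2 * n - 2))⁻¹) (Metric.ball 0 r) := by
    refine (integrableOn_fun_norm_addHaar (f := fun y : ℝ => (y ^ (2 * n - 2))⁻¹) volume).mpr ?_
    rw [hdim]
    have : IntegrableOn (fun y : ℝ => y) (Ioo 0 r) :=
      (continuous_id.integrableOn_Icc (a := 0) (b := r)).mono_set Ioo_subset_Icc_self
    refine this.congr_fun (fun y hy => ?_) measurableSet_Ioo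
    have hy0 : y ≠ 0 := hy.1.ne'
    dsimp only
    rw [smul_eq_mul, show 2 * n - 1 = (2 * n - 2) + 1 by omega, pow_succ]
    field_simp
  rw [← hasFiniteIntegral_iff_ofReal (Filter.Eventually.of_forall fun _ => by positivity)]
  exact hI.2

/-- Integrability of the fundamental solution over a cylinder, uniformly in the pole. -/
theorem lintegral_g_le (hn : 2 ≤ n) (R : ℝ) : ∃ B : ℝ≥0∞, B ≠ ⊤ ∧ ∀ η : Heis n, ‖η.1‖ ≤ R →
    ∫⁻ ξ in Metric.ball (0 : Fin n → ℂ) R ×ˢ univ, ENNReal.ofReal (g η ξ) ≤ B := by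
  obtain ⟨c, hc, hle⟩ := lintegral_g_snd hn
  have : Nonempty (Fin n) := ⟨⟨0, by omega⟩⟩
  refine ⟨c * ∫⁻ z in Metric.ball (0 : Fin n → ℂ) (2 * R), ENNReal.ofReal ((‖z‖ ^ (2 * n - 2))⁻¹),
    ENNReal.mul_ne_top hc (lintegral_inv_norm_pow_lt_top hn _).ne, fun η hη => ?_⟩
  rw [Measure.volume_eq_prod, ← Measure.prod_restrict, Measure.restrict_univ,
    lintegral_prod _ (measurable_g η).ennreal_ofReal.aemeasurable]
  calc ∫⁻ z in Metric.ball (0 : Fin n → ℂ) R, ∫⁻ t : ℝ, ENNReal.ofReal (g η (z, t))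
      ≤ ∫⁻ z in Metric.ball (0 : Fin n → ℂ) R,
          c * ENNReal.ofReal ((‖η.1 - z‖ ^ (2 * n - 2))⁻¹) := by
        refine lintegral_mono_ae (ae_restrict_of_ae ?_)
        filter_upwards [compl_mem_ae_iff.mpr (measure_singleton η.1)] with z hz
        exact hle η z fun h => hz h.symm
    _ = c * ∫⁻ z in Metric.ball (0 : Fin n → ℂ) R,
          ENNReal.ofReal ((‖η.1 - z‖ ^ (2 * n - 2))⁻¹) := by
        rw [lintegral_const_mul _ (by fun_prop)]
    -- For `‖η.1‖ ≤ R`, `η.1 - z` stays in the ball of radius `2R`; translation then removes the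
    -- pole.
    _ ≤ c * ∫⁻ z, (Metric.ball (0 : Fin n → ℂ) (2 * R)).indicator
          (fun z => ENNReal.ofReal ((‖z‖ ^ (2 * n - 2))⁻¹)) (η.1 - z) := by
        refine mul_le_mul' le_rfl ?_
        rw [← lintegral_indicator measurableSet_ball]
        refine lintegral_mono fun z => ?_
        by_cases hz : z ∈ Metric.ball (0 : Fin n → ℂ) R
        · rw [indicator_of_mem hz, indicator_of_mem]
          rw [mem_ball_zero_iff] at hz ⊢
          linarith [norm_sub_le η.1 z]
        · rw [indicator_of_notMem hz]
          exact zero_le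
    _ = _ := by
        rw [lintegral_sub_left_eq_self, lintegral_indicator measurableSet_ball]

end Heisenberg

/-! ### Vector fields, integration by parts and symmetry of `L₀` -/

namespace Heisenberg

open MeasureTheory

variable {n : ℕ}

instance isAddHaarMeasure_volume : (volume : Measure (Heis n)).IsAddHaarMeasure :=
  Measure.prod.instIsAddHaarMeasure (volume : Measure (Fin n → ℂ)) (volume : Measure ℝ)

/-- The first order operator `a ∂_{x_j} + b ∂_{y_j} + c(z) ∂_t`. -/
noncomputable def vf (a b : ℂ) (c : (Fin n → ℂ) → ℂ) (j : Fin n) (f : Heis n → ℂ) (ξ : Heis n) : ℂ :=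
  a * dx j f ξ + b * dy j f ξ + c ξ.1 * T f ξ

theorem Z_eq_vf (j : Fin n) : Z j = vf (1 / 2) (-Complex.I / 2)
    (fun z : Fin n → ℂ => Complex.I * starRingEnd ℂ (z j)) j := by
  funext f ξ; simp only [Z, vf]; ring

theorem Zbar_eq_vf (j : Fin n) : Zbar j = vf (1 / 2) (Complex.I / 2)
    (fun z : Fin n → ℂ => -(Complex.I * z j)) j := by
  funext f ξ; simp only [Zbar, vf]; ring

section VectorFields

variable {a b : ℂ} {c : (Fin n → ℂ) → ℂ} {j : Fin n}

theorem contDiff_vf (hc : ContDiff ℝ ∞ c) {f : Heis n → ℂ} (hf : ContDiff ℝ ∞ f) :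
    ContDiff ℝ ∞ (vf a b c j f) := by
  have h : ∀ v : Heis n, ContDiff ℝ ∞ fun ξ => fderiv ℝ f ξ v := fun v =>
    (hf.fderiv_right (m := ∞) (by simp)).clm_apply contDiff_const
  exact ((contDiff_const.mul (h _)).add (contDiff_const.mul (h _))).add
    ((hc.comp contDiff_fst).mul (h _))

theorem vf_eq_zero_of_notMem_tsupport {f : Heis n → ℂ} {ξ : Heis n} (h : ξ ∉ tsupport f) :
    vf a b c j f ξ = 0 := by
  have h0 : fderiv ℝ f ξ = 0 := by
    by_contra hne
    exact h (support_fderiv_subset ℝ hne)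
  simp [vf, dx, dy, T, h0]

theorem tsupport_vf_subset (f : Heis n → ℂ) : tsupport (vf a b c j f) ⊆ tsupport f := by
  refine closure_minimal (fun ξ hξ => ?_) (isClosed_tsupport f)
  by_contra h
  exact hξ (vf_eq_zero_of_notMem_tsupport h)

theorem hasCompactSupport_vf {f : Heis n → ℂ} (hf : HasCompactSupport f) :
    HasCompactSupport (vf a b c j f) :=
  hf.of_isClosed_subset (isClosed_tsupport _) (tsupport_vf_subset f)

theorem integral_mul_fderiv {u φ : Heis n → ℂ} (hu : ContDiff ℝ ∞ u) (hφ : ContDiff ℝ ∞ φ)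
    (hs : HasCompactSupport φ) (v : Heis n) :
    ∫ ξ, u ξ * fderiv ℝ φ ξ v = -∫ ξ, fderiv ℝ u ξ v * φ ξ := by
  have h : ∀ {f : Heis n → ℂ}, ContDiff ℝ ∞ f → Continuous fun ξ => fderiv ℝ f ξ v := fun hf =>
    (hf.continuous_fderiv (by simp)).clm_apply continuous_const
  have hs' : HasCompactSupport fun ξ => fderiv ℝ φ ξ v := hs.fderiv_apply (𝕜 := ℝ) v
  refine integral_mul_fderiv_eq_neg_fderiv_mul_of_integrable ?_ ?_ ?_
    (fun x _ => (hu.differentiable (by simp)) x) (fun x _ => (hφ.differentiable (by simp)) x)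
  · exact ((h hu).mul hφ.continuous).integrable_of_hasCompactSupport hs.mul_left
  · exact (hu.continuous.mul (h hφ)).integrable_of_hasCompactSupport hs'.mul_left
  · exact (hu.continuous.mul hφ.continuous).integrable_of_hasCompactSupport hs.mul_left

/-- The coefficient of `∂_t` does not involve `t`. This makes `vf` divergence free, so integration
by parts produces no zeroth-order term. -/
theorem T_mul_fst (hc : ContDiff ℝ ∞ c) {u : Heis n → ℂ} (hu : ContDiff ℝ ∞ u) (ξ : Heis n) :
    T (fun ξ => u ξ * c ξ.1) ξ = c ξ.1 * T u ξ := by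
  have h1 : HasFDerivAt (fun ξ : Heis n => c ξ.1)
      ((fderiv ℝ c ξ.1).comp (ContinuousLinearMap.fst ℝ _ _)) ξ :=
    ((hc.differentiable (by simp)) ξ.1).hasFDerivAt.comp ξ hasFDerivAt_fst
  have h2 := ((hu.differentiable (by simp)) ξ).hasFDerivAt.fun_mul h1
  rw [T, h2.fderiv]
  simp [T]

/-- Integration by parts for a divergence free first order operator. -/
theorem integral_mul_vf (hc : ContDiff ℝ ∞ c) {u φ : Heis n → ℂ} (hu : ContDiff ℝ ∞ u)
    (hφ : ContDiff ℝ ∞ φ) (hs : HasCompactSupport φ) :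
    ∫ ξ, u ξ * vf a b c j φ ξ = -∫ ξ, vf a b c j u ξ * φ ξ := by
  have hd : ∀ {f : Heis n → ℂ} (v : Heis n), ContDiff ℝ ∞ f → Continuous fun ξ => fderiv ℝ f ξ v :=
    fun v hf => (hf.continuous_fderiv (by simp)).clm_apply continuous_const
  have hs' : ∀ v, HasCompactSupport fun ξ => fderiv ℝ φ ξ v := fun v => hs.fderiv_apply (𝕜 := ℝ) v
  have huc : ContDiff ℝ ∞ fun ξ : Heis n => u ξ * c ξ.1 := hu.mul (hc.comp contDiff_fst)
  have e1 : ∀ ξ, u ξ * vf a b c j φ ξ = a * (u ξ * fderiv ℝ φ ξ (Pi.single j 1, 0)) +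
      b * (u ξ * fderiv ℝ φ ξ (Pi.single j Complex.I, 0)) +
      u ξ * c ξ.1 * fderiv ℝ φ ξ (0, 1) := by
    intro ξ; simp only [vf, dx, dy, T]; ring
  have e2 : ∀ ξ, vf a b c j u ξ * φ ξ = a * (fderiv ℝ u ξ (Pi.single j 1, 0) * φ ξ) +
      b * (fderiv ℝ u ξ (Pi.single j Complex.I, 0) * φ ξ) +
      fderiv ℝ (fun ξ => u ξ * c ξ.1) ξ (0, 1) * φ ξ := by
    intro ξ
    have := T_mul_fst hc hu ξ
    simp only [vf, dx, dy, T] at this ⊢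
    rw [this]; ring
  have i1 : ∀ {w : Heis n → ℂ} (v), ContDiff ℝ ∞ w → Integrable fun ξ => w ξ * fderiv ℝ φ ξ v :=
    fun v hw => (hw.continuous.mul (hd v hφ)).integrable_of_hasCompactSupport (hs' v).mul_left
  have i2 : ∀ {w : Heis n → ℂ} (v), ContDiff ℝ ∞ w → Integrable fun ξ => fderiv ℝ w ξ v * φ ξ :=
    fun v hw => ((hd v hw).mul hφ.continuous).integrable_of_hasCompactSupport hs.mul_left
  simp only [e1, e2]
  rw [integral_add (((i1 _ hu).const_mul a).fun_add ((i1 _ hu).const_mul b)) (i1 _ huc),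
    integral_add ((i1 _ hu).const_mul a) ((i1 _ hu).const_mul b),
    integral_add (((i2 _ hu).const_mul a).fun_add ((i2 _ hu).const_mul b)) (i2 _ huc),
    integral_add ((i2 _ hu).const_mul a) ((i2 _ hu).const_mul b)]
  simp only [integral_const_mul]
  rw [integral_mul_fderiv hu hφ hs, integral_mul_fderiv hu hφ hs, integral_mul_fderiv huc hφ hs]
  ring

/-- `f` is differentiable at `ξ`, and the operator `vf a b c j` takes the value `d` on it. -/
def HasVF (a b : ℂ) (c : (Fin n → ℂ) → ℂ) (j : Fin n) (f : Heis n → ℂ) (d : ℂ) (ξ : Heis n) :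
    Prop :=
  DifferentiableAt ℝ f ξ ∧ vf a b c j f ξ = d

variable {f h : Heis n → ℂ} {d e : ℂ} {ξ : Heis n}

theorem HasVF.add (hf : HasVF a b c j f d ξ) (hh : HasVF a b c j h e ξ) :
    HasVF a b c j (fun ξ => f ξ + h ξ) (d + e) ξ := by
  refine ⟨hf.1.add hh.1, ?_⟩
  rw [← hf.2, ← hh.2]
  simp only [vf, dx, dy, T]
  rw [fderiv_fun_add hf.1 hh.1]
  simp only [add_apply]
  ring

theorem HasVF.mul (hf : HasVF a b c j f d ξ) (hh : HasVF a b c j h e ξ) :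
    HasVF a b c j (fun ξ => f ξ * h ξ) (f ξ * e + d * h ξ) ξ := by
  refine ⟨hf.1.mul hh.1, ?_⟩
  rw [← hf.2, ← hh.2]
  simp only [vf, dx, dy, T]
  rw [fderiv_fun_mul hf.1 hh.1]
  simp only [add_apply, smul_apply, smul_eq_mul]
  ring

theorem hasVF_const (k : ℂ) : HasVF a b c j (fun _ => k) 0 ξ :=
  ⟨differentiableAt_const k, by simp [vf, dx, dy, T]⟩

theorem HasVF.const_mul (k : ℂ) (hf : HasVF a b c j f d ξ) :
    HasVF a b c j (fun ξ => k * f ξ) (k * d) ξ := by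
  have := (hasVF_const (a := a) (b := b) (c := c) (j := j) (ξ := ξ) k).mul hf
  simpa using this

theorem HasVF.sum {ι : Type*} (s : Finset ι) {f : ι → Heis n → ℂ} {d : ι → ℂ}
    (hf : ∀ i ∈ s, HasVF a b c j (f i) (d i) ξ) :
    HasVF a b c j (fun ξ => ∑ i ∈ s, f i ξ) (∑ i ∈ s, d i) ξ := by
  classical
  induction s using Finset.induction_on with
  | empty => simpa using hasVF_const 0
  | insert i s hi ih =>
    simp only [Finset.sum_insert hi]
    exact (hf i (Finset.mem_insert_self i s)).add
      (ih fun k hk => hf k (Finset.mem_insert_of_mem hk))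

theorem HasVF.ofReal_comp {q : Heis n → ℝ} {ρ : ℝ → ℝ} {ρ' : ℝ}
    (hq : HasVF a b c j (fun ξ => (q ξ : ℂ)) d ξ) (hρ : HasDerivAt ρ ρ' (q ξ)) :
    HasVF a b c j (fun ξ => ((ρ (q ξ) : ℝ) : ℂ)) (ρ' * d) ξ := by
  have hqr : DifferentiableAt ℝ q ξ := by
    have := Complex.reCLM.differentiableAt.comp ξ hq.1
    simpa [Function.comp_def] using this
  have h1 : HasFDerivAt (fun ξ => (q ξ : ℂ)) (Complex.ofRealCLM.comp (fderiv ℝ q ξ)) ξ :=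
    Complex.ofRealCLM.hasFDerivAt.comp ξ hqr.hasFDerivAt
  have h2 : HasFDerivAt (fun ξ => ((ρ (q ξ) : ℝ) : ℂ))
      (Complex.ofRealCLM.comp (ρ' • fderiv ℝ q ξ)) ξ :=
    Complex.ofRealCLM.hasFDerivAt.comp ξ (hρ.comp_hasFDerivAt ξ hqr.hasFDerivAt)
  refine ⟨h2.differentiableAt, ?_⟩
  rw [← hq.2]
  simp only [vf, dx, dy, T]
  rw [h1.fderiv, h2.fderiv]
  simp
  ring

theorem hasVF_coord (k : Fin n) :
    HasVF a b c j (fun ξ => ξ.1 k) (if k = j then a + b * Complex.I else 0) ξ := by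
  have h1 : HasFDerivAt (fun ξ : Heis n => ξ.1 k)
      ((ContinuousLinearMap.proj k).comp (ContinuousLinearMap.fst ℝ (Fin n → ℂ) ℝ)) ξ :=
    ((ContinuousLinearMap.proj k).comp (ContinuousLinearMap.fst ℝ (Fin n → ℂ) ℝ)).hasFDerivAt
  refine ⟨h1.differentiableAt, ?_⟩
  simp only [vf, dx, dy, T]
  rw [h1.fderiv]
  split_ifs with h
  · subst h; simp
  · simp [Pi.single_eq_of_ne h]

theorem hasVF_conj_coord (k : Fin n) :
    HasVF a b c j (fun ξ => starRingEnd ℂ (ξ.1 k)) (if k = j then a - b * Complex.I else 0) ξ := by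
  have h1 : HasFDerivAt (fun ξ : Heis n => starRingEnd ℂ (ξ.1 k))
      ((Complex.conjCLE : ℂ →L[ℝ] ℂ).comp
        ((ContinuousLinearMap.proj k).comp (ContinuousLinearMap.fst ℝ (Fin n → ℂ) ℝ))) ξ :=
    ((Complex.conjCLE : ℂ →L[ℝ] ℂ).comp
        ((ContinuousLinearMap.proj k).comp (ContinuousLinearMap.fst ℝ (Fin n → ℂ) ℝ))).hasFDerivAt
  refine ⟨h1.differentiableAt, ?_⟩
  simp only [vf, dx, dy, T]
  rw [h1.fderiv]
  split_ifs with h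
  · subst h; simp; ring
  · simp [Pi.single_eq_of_ne h]

theorem hasVF_snd : HasVF a b c j (fun ξ => (ξ.2 : ℂ)) (c ξ.1) ξ := by
  have h1 : HasFDerivAt (fun ξ : Heis n => (ξ.2 : ℂ))
      (Complex.ofRealCLM.comp (ContinuousLinearMap.snd ℝ (Fin n → ℂ) ℝ)) ξ :=
    (Complex.ofRealCLM.comp (ContinuousLinearMap.snd ℝ (Fin n → ℂ) ℝ)).hasFDerivAt
  refine ⟨h1.differentiableAt, ?_⟩
  simp only [vf, dx, dy, T]
  rw [h1.fderiv]
  simp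

end VectorFields

theorem contDiff_coord (j : Fin n) : ContDiff ℝ ∞ fun z : Fin n → ℂ => z j :=
  contDiff_apply ℝ ℂ j

theorem contDiff_Z_coeff (j : Fin n) :
    ContDiff ℝ ∞ fun z : Fin n → ℂ => Complex.I * starRingEnd ℂ (z j) :=
  contDiff_const.mul (Complex.conjCLE.contDiff.comp (contDiff_coord j))

theorem contDiff_Zbar_coeff (j : Fin n) : ContDiff ℝ ∞ fun z : Fin n → ℂ => -(Complex.I * z j) :=
  (contDiff_const.mul (contDiff_coord j)).neg

section SubLaplacian

variable {u φ : Heis n → ℂ}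

theorem contDiff_Z (j : Fin n) (hu : ContDiff ℝ ∞ u) : ContDiff ℝ ∞ (Z j u) := by
  rw [Z_eq_vf]; exact contDiff_vf (contDiff_Z_coeff j) hu

theorem contDiff_Zbar (j : Fin n) (hu : ContDiff ℝ ∞ u) : ContDiff ℝ ∞ (Zbar j u) := by
  rw [Zbar_eq_vf]; exact contDiff_vf (contDiff_Zbar_coeff j) hu

theorem hasCompactSupport_Z (j : Fin n) (hu : HasCompactSupport u) : HasCompactSupport (Z j u) := by
  rw [Z_eq_vf]; exact hasCompactSupport_vf hu

theorem hasCompactSupport_Zbar (j : Fin n) (hu : HasCompactSupport u) :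
    HasCompactSupport (Zbar j u) := by
  rw [Zbar_eq_vf]; exact hasCompactSupport_vf hu

theorem integral_mul_Z (j : Fin n) (hu : ContDiff ℝ ∞ u) (hφ : ContDiff ℝ ∞ φ)
    (hs : HasCompactSupport φ) : ∫ ξ, u ξ * Z j φ ξ = -∫ ξ, Z j u ξ * φ ξ := by
  rw [Z_eq_vf]; exact integral_mul_vf (contDiff_Z_coeff j) hu hφ hs

theorem integral_mul_Zbar (j : Fin n) (hu : ContDiff ℝ ∞ u) (hφ : ContDiff ℝ ∞ φ)
    (hs : HasCompactSupport φ) : ∫ ξ, u ξ * Zbar j φ ξ = -∫ ξ, Zbar j u ξ * φ ξ := by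
  rw [Zbar_eq_vf]; exact integral_mul_vf (contDiff_Zbar_coeff j) hu hφ hs

theorem continuous_L0 (hφ : ContDiff ℝ ∞ φ) : Continuous (L0 φ) := by
  unfold L0 subLaplacian
  refine continuous_const.mul (continuous_const.mul (continuous_finsetSum _ fun j _ => ?_))
  exact (contDiff_Zbar j (contDiff_Z j hφ)).continuous.add
    (contDiff_Z j (contDiff_Zbar j hφ)).continuous

theorem L0_eq_zero_of_notMem_tsupport {ξ : Heis n} (h : ξ ∉ tsupport φ) : L0 φ ξ = 0 := by
  have h1 : ∀ j, Zbar j (Z j φ) ξ = 0 := fun j => by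
    rw [Zbar_eq_vf, Z_eq_vf]
    exact vf_eq_zero_of_notMem_tsupport fun hm => h (tsupport_vf_subset φ hm)
  have h2 : ∀ j, Z j (Zbar j φ) ξ = 0 := fun j => by
    rw [Zbar_eq_vf, Z_eq_vf]
    exact vf_eq_zero_of_notMem_tsupport fun hm => h (tsupport_vf_subset φ hm)
  simp [L0, subLaplacian, h1, h2]

theorem hasCompactSupport_L0 (hs : HasCompactSupport φ) : HasCompactSupport (L0 φ) :=
  HasCompactSupport.intro hs fun _ h => L0_eq_zero_of_notMem_tsupport h

/-- `L₀` is formally symmetric. -/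
theorem integral_mul_L0 (hu : ContDiff ℝ ∞ u) (hφ : ContDiff ℝ ∞ φ) (hs : HasCompactSupport φ) :
    ∫ ξ, u ξ * L0 φ ξ = ∫ ξ, L0 u ξ * φ ξ := by
  have e1 : ∀ ξ, u ξ * L0 φ ξ =
      (-1 / 2) * ∑ j, (u ξ * Zbar j (Z j φ) ξ + u ξ * Z j (Zbar j φ) ξ) := by
    intro ξ; simp only [L0, subLaplacian, ← mul_add, ← Finset.mul_sum]; ring
  have e2 : ∀ ξ, L0 u ξ * φ ξ =
      (-1 / 2) * ∑ j, (Zbar j (Z j u) ξ * φ ξ + Z j (Zbar j u) ξ * φ ξ) := by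
    intro ξ; simp only [L0, subLaplacian, ← add_mul, ← Finset.sum_mul]; ring
  have i : ∀ {f h : Heis n → ℂ}, ContDiff ℝ ∞ f → ContDiff ℝ ∞ h → HasCompactSupport h →
      Integrable fun ξ => f ξ * h ξ := fun hf hh hs =>
    (hf.continuous.mul hh.continuous).integrable_of_hasCompactSupport hs.mul_left
  have i1 : ∀ j, Integrable fun ξ => u ξ * Zbar j (Z j φ) ξ := fun j =>
    i hu (contDiff_Zbar j (contDiff_Z j hφ)) (hasCompactSupport_Zbar j (hasCompactSupport_Z j hs))
  have i2 : ∀ j, Integrable fun ξ => u ξ * Z j (Zbar j φ) ξ := fun j =>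
    i hu (contDiff_Z j (contDiff_Zbar j hφ)) (hasCompactSupport_Z j (hasCompactSupport_Zbar j hs))
  have i3 : ∀ j, Integrable fun ξ => Zbar j (Z j u) ξ * φ ξ := fun j =>
    i (contDiff_Zbar j (contDiff_Z j hu)) hφ hs
  have i4 : ∀ j, Integrable fun ξ => Z j (Zbar j u) ξ * φ ξ := fun j =>
    i (contDiff_Z j (contDiff_Zbar j hu)) hφ hs
  simp only [e1, e2, integral_const_mul]
  rw [integral_finsetSum _ fun j _ => (i1 j).fun_add (i2 j),
    integral_finsetSum _ fun j _ => (i3 j).fun_add (i4 j)]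
  congr 1
  refine Finset.sum_congr rfl fun j _ => ?_
  rw [integral_add (i1 j) (i2 j), integral_add (i3 j) (i4 j),
    integral_mul_Zbar j hu (contDiff_Z j hφ) (hasCompactSupport_Z j hs),
    integral_mul_Z j (contDiff_Zbar j hu) hφ hs,
    integral_mul_Z j hu (contDiff_Zbar j hφ) (hasCompactSupport_Zbar j hs),
    integral_mul_Zbar j (contDiff_Z j hu) hφ hs]
  ring

end SubLaplacian

end Heisenberg

/-! ### The regularised fundamental solution -/

namespace Heisenberg

open MeasureTheory

variable {n : ℕ}

/-- The complex function `A_e = C - P + e`, for which `g_η = a₀ |A_0|⁻ⁿ`. -/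
noncomputable def reg (e : ℝ) (η ξ : Heis n) : ℂ := C η.2 η ξ - P η ξ + e

/-- `|A_e|²`. -/
noncomputable def regSq (e : ℝ) (η ξ : Heis n) : ℝ := ‖reg e η ξ‖ ^ 2

/-- The regularised fundamental solution `a₀ |A_e|⁻ⁿ`. -/
noncomputable def regSol (e : ℝ) (η ξ : Heis n) : ℝ := a0 n * regSq e η ξ ^ (-(n : ℝ) / 2)

theorem reg_re (e : ℝ) (η ξ : Heis n) : (reg e η ξ).re = normSq (ξ.1 - η.1) + e := by
  rw [← neg_sub η.1 ξ.1, normSq_neg, normSq_sub, reg, Complex.add_re, Complex.sub_re, C_re, P,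
    Complex.ofReal_re]

theorem reg_im (e : ℝ) (η ξ : Heis n) : (reg e η ξ).im = (reg 0 η ξ).im := by
  simp [reg]

theorem regSq_eq (e : ℝ) (η ξ : Heis n) :
    regSq e η ξ = (normSq (ξ.1 - η.1) + e) ^ 2 + (reg 0 η ξ).im ^ 2 := by
  rw [regSq, ← Complex.normSq_eq_norm_sq, Complex.normSq_apply, reg_re, reg_im]; ring

theorem regSq_pos {e : ℝ} (he : 0 < e) (η ξ : Heis n) : 0 < regSq e η ξ := by
  have := normSq_nonneg (ξ.1 - η.1)
  rw [regSq_eq]; positivity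

theorem contDiff_reg (e : ℝ) (η : Heis n) : ContDiff ℝ ∞ (reg e η) :=
  ((contDiff_C η.2 η).sub (contDiff_P η)).add contDiff_const

theorem contDiff_regSq (e : ℝ) (η : Heis n) : ContDiff ℝ ∞ (regSq e η) :=
  (contDiff_reg e η).norm_sq ℝ

theorem contDiff_regSol {e : ℝ} (he : 0 < e) (η : Heis n) :
    ContDiff ℝ ∞ fun ξ => (regSol e η ξ : ℂ) :=
  Complex.ofRealCLM.contDiff.comp (contDiff_const.mul
    ((contDiff_regSq e η).rpow_const_of_ne fun ξ => (regSq_pos he η ξ).ne'))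

theorem reg_eq_sum (e : ℝ) (η : Heis n) :
    reg e η = fun ξ => (normSq η.1 + e - Complex.I * η.2 : ℂ) + (Complex.I * ξ.2 +
      ∑ k, (ξ.1 k * starRingEnd ℂ (ξ.1 k) + -2 * η.1 k * starRingEnd ℂ (ξ.1 k))) := by
  funext ξ
  simp only [reg, C, P, herm, Finset.sum_add_distrib, Complex.mul_conj, Complex.normSq_eq_norm_sq,
    Finset.mul_sum, normSq, mul_assoc, neg_mul, Finset.sum_neg_distrib]
  push_cast
  ring

theorem conj_reg_eq_sum (e : ℝ) (η : Heis n) :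
    (fun ξ => starRingEnd ℂ (reg e η ξ)) = fun ξ => (normSq η.1 + e + Complex.I * η.2 : ℂ) +
      (-Complex.I * ξ.2 + ∑ k, (ξ.1 k * starRingEnd ℂ (ξ.1 k) +
        -2 * starRingEnd ℂ (η.1 k) * ξ.1 k)) := by
  funext ξ
  rw [reg_eq_sum]
  simp only [map_add, map_sub, map_mul, map_sum, Complex.conj_conj, Complex.conj_ofReal,
    Complex.conj_I, map_neg, map_ofNat, neg_mul, sub_neg_eq_add]
  congr 2
  refine Finset.sum_congr rfl fun k _ => ?_
  ring

section

variable {a b : ℂ} {c : (Fin n → ℂ) → ℂ} {j : Fin n}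

theorem hasVF_reg (e : ℝ) (η ξ : Heis n) :
    HasVF a b c j (reg e η) (Complex.I * c ξ.1 + (ξ.1 j * (a - b * Complex.I) +
      (a + b * Complex.I) * starRingEnd ℂ (ξ.1 j) + -2 * η.1 j * (a - b * Complex.I))) ξ := by
  rw [reg_eq_sum]
  have h := (hasVF_const (a := a) (b := b) (c := c) (j := j) (ξ := ξ)
    (normSq η.1 + e - Complex.I * η.2 : ℂ)).add (((hasVF_snd).const_mul Complex.I).add
    (HasVF.sum Finset.univ fun k _ => ((hasVF_coord k).mul (hasVF_conj_coord k)).add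
      ((hasVF_conj_coord k).const_mul (-2 * η.1 k))))
  convert h using 1
  simp [Finset.sum_add_distrib]

theorem hasVF_conj_reg (e : ℝ) (η ξ : Heis n) :
    HasVF a b c j (fun ξ => starRingEnd ℂ (reg e η ξ)) (-Complex.I * c ξ.1 +
      (ξ.1 j * (a - b * Complex.I) + (a + b * Complex.I) * starRingEnd ℂ (ξ.1 j) +
        -2 * starRingEnd ℂ (η.1 j) * (a + b * Complex.I))) ξ := by
  rw [conj_reg_eq_sum]
  have h := (hasVF_const (a := a) (b := b) (c := c) (j := j) (ξ := ξ)
    (normSq η.1 + e + Complex.I * η.2 : ℂ)).add (((hasVF_snd).const_mul (-Complex.I)).add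
    (HasVF.sum Finset.univ fun k _ => ((hasVF_coord k).mul (hasVF_conj_coord k)).add
      ((hasVF_coord k).const_mul (-2 * starRingEnd ℂ (η.1 k)))))
  convert h using 1
  simp [Finset.sum_add_distrib]

end

/-- Being differentiable with a prescribed value of `Z_j`. -/
abbrev HasZ (j : Fin n) (f : Heis n → ℂ) (d : ℂ) (ξ : Heis n) : Prop :=
  HasVF (1 / 2) (-Complex.I / 2) (fun z : Fin n → ℂ => Complex.I * starRingEnd ℂ (z j)) j f d ξ

/-- Being differentiable with a prescribed value of `Z̄_j`. -/
abbrev HasZbar (j : Fin n) (f : Heis n → ℂ) (d : ℂ) (ξ : Heis n) : Prop :=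
  HasVF (1 / 2) (Complex.I / 2) (fun z : Fin n → ℂ => -(Complex.I * z j)) j f d ξ

theorem HasZ.eq {j : Fin n} {f : Heis n → ℂ} {d : ℂ} {ξ : Heis n} (h : HasZ j f d ξ) :
    Z j f ξ = d := by rw [Z_eq_vf]; exact h.2

theorem HasZbar.eq {j : Fin n} {f : Heis n → ℂ} {d : ℂ} {ξ : Heis n} (h : HasZbar j f d ξ) :
    Zbar j f ξ = d := by rw [Zbar_eq_vf]; exact h.2

theorem half_sub : (1 / 2 : ℂ) - -Complex.I / 2 * Complex.I = 0 := by
  linear_combination (1 / 2) * Complex.I_mul_I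
theorem half_add : (1 / 2 : ℂ) + -Complex.I / 2 * Complex.I = 1 := by
  linear_combination (-1 / 2) * Complex.I_mul_I
theorem half_sub' : (1 / 2 : ℂ) - Complex.I / 2 * Complex.I = 1 := by
  linear_combination (-1 / 2) * Complex.I_mul_I
theorem half_add' : (1 / 2 : ℂ) + Complex.I / 2 * Complex.I = 0 := by
  linear_combination (1 / 2) * Complex.I_mul_I

variable (e : ℝ) (η ξ : Heis n) (j : Fin n)

/-- The algebraic core: `Z_j` annihilates `A_e` and `Z̄_j` annihilates its conjugate, so each first
derivative of `|A_e|²`, the product of the two, is a single term. -/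
theorem hasZ_reg : HasZ j (reg e η) 0 ξ := by
  convert hasVF_reg e η ξ using 1
  rw [half_sub, half_add]
  linear_combination (-starRingEnd ℂ (ξ.1 j)) * Complex.I_mul_I

theorem hasZ_conj_reg : HasZ j (fun ξ => starRingEnd ℂ (reg e η ξ))
    (2 * starRingEnd ℂ (ξ.1 j - η.1 j)) ξ := by
  convert hasVF_conj_reg e η ξ using 1
  rw [half_sub, half_add, map_sub]
  linear_combination (starRingEnd ℂ (ξ.1 j)) * Complex.I_mul_I

theorem hasZbar_reg : HasZbar j (reg e η) (2 * (ξ.1 j - η.1 j)) ξ := by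
  convert hasVF_reg e η ξ using 1
  rw [half_sub', half_add']
  linear_combination (ξ.1 j) * Complex.I_mul_I

theorem hasZbar_conj_reg : HasZbar j (fun ξ => starRingEnd ℂ (reg e η ξ)) 0 ξ := by
  convert hasVF_conj_reg e η ξ using 1
  rw [half_sub', half_add']
  linear_combination (-(ξ.1 j)) * Complex.I_mul_I

theorem regSq_coe : (fun ξ => (regSq e η ξ : ℂ)) = fun ξ => reg e η ξ * starRingEnd ℂ (reg e η ξ) := by
  funext ξ
  rw [Complex.mul_conj, Complex.normSq_eq_norm_sq, regSq]

theorem hasZ_regSq : HasZ j (fun ξ => (regSq e η ξ : ℂ))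
    (reg e η ξ * (2 * starRingEnd ℂ (ξ.1 j - η.1 j))) ξ := by
  rw [regSq_coe]
  convert (hasZ_reg e η ξ j).mul (hasZ_conj_reg e η ξ j) using 1
  ring

theorem hasZbar_regSq : HasZbar j (fun ξ => (regSq e η ξ : ℂ))
    (2 * (ξ.1 j - η.1 j) * starRingEnd ℂ (reg e η ξ)) ξ := by
  rw [regSq_coe]
  convert (hasZbar_reg e η ξ j).mul (hasZbar_conj_reg e η ξ j) using 1
  ring

theorem hasVF_sub_coord {a b : ℂ} {c : (Fin n → ℂ) → ℂ} :
    HasVF a b c j (fun ξ => ξ.1 j - η.1 j) (a + b * Complex.I) ξ := by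
  have h := (hasVF_coord (a := a) (b := b) (c := c) (j := j) (ξ := ξ) j).add
    (hasVF_const (-(η.1 j)))
  simpa only [if_true, add_zero, ← sub_eq_add_neg] using h

theorem hasVF_conj_sub_coord {a b : ℂ} {c : (Fin n → ℂ) → ℂ} :
    HasVF a b c j (fun ξ => starRingEnd ℂ (ξ.1 j - η.1 j)) (a - b * Complex.I) ξ := by
  have h := (hasVF_conj_coord (a := a) (b := b) (c := c) (j := j) (ξ := ξ) j).add
    (hasVF_const (-(starRingEnd ℂ (η.1 j))))
  simpa only [if_true, add_zero, ← sub_eq_add_neg, map_sub] using h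

variable {e}

/-- `L₀ |A_e|⁻ⁿ = n² e |A_e|⁻ⁿ⁻²`. -/
theorem L0_regSol (he : 0 < e) : L0 (fun ξ => (regSol e η ξ : ℂ)) ξ =
    ((a0 n * n ^ 2 * e * regSq e η ξ ^ (-((n : ℝ) / 2 + 1)) : ℝ) : ℂ) := by
  set α : ℝ := -(n : ℝ) / 2 with hα
  set ρ1 : ℝ → ℝ := fun x => a0 n * (α * x ^ (α - 1)) with hρ1
  have hd0 : ∀ x : ℝ, 0 < x → HasDerivAt (fun x : ℝ => a0 n * x ^ α) (ρ1 x) x := fun x hx =>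
    (Real.hasDerivAt_rpow_const (Or.inl hx.ne')).const_mul (a0 n)
  have hd1 : ∀ x : ℝ, 0 < x →
      HasDerivAt ρ1 (a0 n * (α * ((α - 1) * x ^ (α - 1 - 1)))) x := fun x hx =>
    ((Real.hasDerivAt_rpow_const (Or.inl hx.ne')).const_mul α).const_mul (a0 n)
  have hq : ∀ ξ, 0 < regSq e η ξ := regSq_pos he η
  have hZ : ∀ j, Z j (fun ξ => (regSol e η ξ : ℂ)) = fun ξ =>
      ((ρ1 (regSq e η ξ) : ℝ) : ℂ) * (reg e η ξ * (2 * starRingEnd ℂ (ξ.1 j - η.1 j))) :=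
    fun j => funext fun ξ => HasZ.eq ((hasZ_regSq e η ξ j).ofReal_comp (hd0 _ (hq ξ)))
  have hZb : ∀ j, Zbar j (fun ξ => (regSol e η ξ : ℂ)) = fun ξ =>
      ((ρ1 (regSq e η ξ) : ℝ) : ℂ) * (2 * (ξ.1 j - η.1 j) * starRingEnd ℂ (reg e η ξ)) :=
    fun j => funext fun ξ => HasZbar.eq ((hasZbar_regSq e η ξ j).ofReal_comp (hd0 _ (hq ξ)))
  have hZbZ := fun j => HasZbar.eq (((hasZbar_regSq e η ξ j).ofReal_comp (hd1 _ (hq ξ))).mul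
    ((hasZbar_reg e η ξ j).mul ((hasVF_conj_sub_coord η ξ j).const_mul 2)))
  have hZZb := fun j => HasZ.eq (((hasZ_regSq e η ξ j).ofReal_comp (hd1 _ (hq ξ))).mul
    (((hasVF_sub_coord η ξ j).const_mul 2).mul (hasZ_conj_reg e η ξ j)))
  simp only [L0, subLaplacian, hZ, hZb, hZbZ, hZZb]
  rw [half_sub', half_add]
  set q := regSq e η ξ with hqdef
  set r2 : ℝ := a0 n * (α * ((α - 1) * q ^ (α - 1 - 1))) with hr2
  set A := reg e η ξ with hA
  have hqA : (q : ℂ) = A * starRingEnd ℂ A := congrFun (regSq_coe e η) ξ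
  have hw : ∀ j, (ξ.1 j - η.1 j) * starRingEnd ℂ (ξ.1 j - η.1 j) =
      ((‖ξ.1 j - η.1 j‖ ^ 2 : ℝ) : ℂ) := fun j => by
    rw [Complex.mul_conj, Complex.normSq_eq_norm_sq]
  have hre : A + starRingEnd ℂ A = ((2 * (normSq (ξ.1 - η.1) + e) : ℝ) : ℂ) := by
    rw [Complex.add_conj, hA, reg_re]
  -- Adding the two orders of differentiation brings in `A + Ā = 2 (|z' - z|² + e)` and `q = A Ā`,
  -- so every summand becomes real.
  have hterm : ∀ j : Fin n,
      ((ρ1 q : ℝ) : ℂ) * (A * (2 * 1) +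
        2 * (ξ.1 j - η.1 j) * (2 * starRingEnd ℂ (ξ.1 j - η.1 j))) +
      (r2 : ℂ) * (2 * (ξ.1 j - η.1 j) * starRingEnd ℂ A) *
        (A * (2 * starRingEnd ℂ (ξ.1 j - η.1 j))) +
      (((ρ1 q : ℝ) : ℂ) * (2 * (ξ.1 j - η.1 j) * (2 * starRingEnd ℂ (ξ.1 j - η.1 j)) +
        2 * 1 * starRingEnd ℂ A) +
      (r2 : ℂ) * (A * (2 * starRingEnd ℂ (ξ.1 j - η.1 j))) *
        (2 * (ξ.1 j - η.1 j) * starRingEnd ℂ A)) =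
      ((8 * (r2 * q + ρ1 q) * ‖(ξ.1 - η.1) j‖ ^ 2 + 4 * ρ1 q * (normSq (ξ.1 - η.1) + e) : ℝ) : ℂ) := by
    intro j
    have h1 := hw j
    push_cast at h1 hre ⊢
    rw [Pi.sub_apply]
    linear_combination (8 * (ρ1 q : ℂ) + 8 * (r2 : ℂ) * q) * h1 + 2 * (ρ1 q : ℂ) * hre -
      8 * (r2 : ℂ) * (ξ.1 j - η.1 j) * starRingEnd ℂ (ξ.1 j - η.1 j) * hqA
  rw [Finset.sum_congr rfl fun j _ => hterm j, ← Complex.ofReal_sum, Finset.sum_add_distrib,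
    ← Finset.mul_sum, Finset.sum_const, Finset.card_univ, Fintype.card_fin, nsmul_eq_mul]
  rw [show ∑ j, ‖(ξ.1 - η.1) j‖ ^ 2 = normSq (ξ.1 - η.1) from rfl]
  -- For `α = -n/2`, `8 (r2 q + ρ1) = 8 α ρ1 = -4n ρ1`. This cancels the `|z' - z|²` part of the `n`
  -- copies of `4 ρ1 (|z' - z|² + e)`, and only the term with `e` survives.
  have hr2q : r2 * q = a0 n * α * (α - 1) * q ^ (α - 1) := by
    have hq0 : q ≠ 0 := (hq ξ).ne'
    rw [hr2, Real.rpow_sub_one hq0 (α - 1)]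
    field_simp
  rw [hr2q, hρ1, show -((n : ℝ) / 2 + 1) = α - 1 by rw [hα]; ring]
  have hn : (n : ℝ) = -2 * α := by rw [hα]; ring
  rw [hn]
  push_cast
  ring

end Heisenberg

/-! ### Passage to the limit: `g` is a fundamental solution -/

namespace Heisenberg

open MeasureTheory Set
open scoped ENNReal

variable {n : ℕ}

theorem g_eq_reg (η ξ : Heis n) : g η ξ = a0 n * ‖reg 0 η ξ‖ ^ (-(n : ℝ)) := by
  have h := g_eq η.2 η ξ
  rw [show ((η.1, η.2) : Heis n) = η from rfl] at h
  rw [h, reg, Complex.ofReal_zero, add_zero]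

theorem regSol_eq (e : ℝ) (η ξ : Heis n) : regSol e η ξ = a0 n * ‖reg e η ξ‖ ^ (-(n : ℝ)) := by
  rw [regSol, regSq, ← Real.rpow_natCast, ← Real.rpow_mul (norm_nonneg _)]
  congr 2
  push_cast
  ring

theorem reg_ne_zero {e : ℝ} (he : 0 ≤ e) {η ξ : Heis n} (h : η.1 ≠ ξ.1) : reg e η ξ ≠ 0 := by
  intro h0
  have h1 := reg_re e η ξ
  rw [h0, Complex.zero_re] at h1
  have h2 := normSq_nonneg (ξ.1 - η.1)
  have h3 : normSq (ξ.1 - η.1) = 0 := by linarith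
  exact h (sub_eq_zero.mp (normSq_eq_zero.mp h3)).symm

/-- Adding `e` increases a nonnegative real part and keeps the imaginary part, so `g` is a
dominating function. The condition on `z` excludes the pole, where the real power of 0 takes the
value 0 instead of infinity; the excluded set is null. -/
theorem regSol_le_g {e : ℝ} (he : 0 ≤ e) {η ξ : Heis n} (h : η.1 ≠ ξ.1) :
    regSol e η ξ ≤ g η ξ := by
  rw [regSol_eq, g_eq_reg]
  refine mul_le_mul_of_nonneg_left ?_ (a0_nonneg n)
  refine Real.rpow_le_rpow_of_nonpos (norm_pos_iff.mpr (reg_ne_zero le_rfl h)) ?_ (by simp)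
  refine pow_le_pow_iff_left₀ (norm_nonneg _) (norm_nonneg _) two_ne_zero |>.mp ?_
  change regSq 0 η ξ ≤ regSq e η ξ
  rw [regSq_eq, regSq_eq]
  have := normSq_nonneg (ξ.1 - η.1)
  gcongr

theorem regSol_nonneg (e : ℝ) (η ξ : Heis n) : 0 ≤ regSol e η ξ := by
  rw [regSol_eq]; exact mul_nonneg (a0_nonneg n) (Real.rpow_nonneg (norm_nonneg _) _)

theorem tendsto_regSol {η ξ : Heis n} (h : η.1 ≠ ξ.1) :
    Filter.Tendsto (fun e => regSol e η ξ) (𝓝 0) (𝓝 (g η ξ)) := by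
  simp only [regSol_eq]
  rw [g_eq_reg]
  have hc : Continuous fun e : ℝ => reg e η ξ := by unfold reg; fun_prop
  refine Filter.Tendsto.const_mul _ (Filter.Tendsto.rpow_const ?_ (Or.inl ?_))
  · exact (hc.norm.tendsto 0)
  · exact norm_ne_zero_iff.mpr (reg_ne_zero le_rfl h)

theorem ae_fst_ne (hn : 0 < n) (z : Fin n → ℂ) : ∀ᵐ ξ : Heis n, z ≠ ξ.1 := by
  have : Nonempty (Fin n) := ⟨⟨0, hn⟩⟩
  have h : (volume : Measure (Heis n)) (Prod.fst ⁻¹' {z}) = 0 := by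
    rw [← Set.prod_univ, Measure.volume_eq_prod, Measure.prod_prod, measure_singleton, zero_mul]
  filter_upwards [compl_mem_ae_iff.mpr h] with ξ hξ h
  exact hξ h.symm

theorem exists_tsupport_subset_ball {ψ : Heis n → ℂ} (hs : HasCompactSupport ψ) (r : ℝ) :
    ∃ R, r ≤ R ∧ ∀ ξ, ψ ξ ≠ 0 → ξ ∈ Metric.ball (0 : Fin n → ℂ) R ×ˢ (univ : Set ℝ) := by
  obtain ⟨R, hR⟩ := hs.isBounded.subset_ball (0 : Heis n)
  refine ⟨max r R, le_max_left _ _, fun ξ hξ => ⟨?_, mem_univ _⟩⟩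
  have h1 := hR (subset_tsupport _ hξ)
  rw [mem_ball_zero_iff] at h1 ⊢
  exact (norm_fst_le ξ).trans_lt (h1.trans_le (le_max_right _ _))

theorem integrableOn_g (hn : 2 ≤ n) (η : Heis n) {R : ℝ} (hR : ‖η.1‖ ≤ R) :
    IntegrableOn (g η) (Metric.ball (0 : Fin n → ℂ) R ×ˢ univ) := by
  obtain ⟨B, hB, hle⟩ := lintegral_g_le hn R
  refine ⟨(measurable_g η).aestronglyMeasurable, ?_⟩
  rw [hasFiniteIntegral_iff_ofReal (Filter.Eventually.of_forall (g_nonneg η))]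
  exact (hle η hR).trans_lt hB.lt_top

theorem integrable_g_mul (hn : 2 ≤ n) (η : Heis n) {ψ : Heis n → ℂ} (hc : Continuous ψ)
    (hs : HasCompactSupport ψ) : Integrable fun ξ => (g η ξ : ℂ) * ψ ξ := by
  obtain ⟨R, hR, hsub⟩ := exists_tsupport_subset_ball hs ‖η.1‖
  obtain ⟨M, hM⟩ := hs.exists_bound_of_continuous hc
  have h1 := (integrableOn_g hn η hR).ofReal (𝕜 := ℂ)
  have h2 : IntegrableOn (fun ξ => (g η ξ : ℂ) * ψ ξ) (Metric.ball (0 : Fin n → ℂ) R ×ˢ univ) :=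
    h1.mul_bdd hc.aestronglyMeasurable (Filter.Eventually.of_forall hM)
  refine (integrableOn_iff_integrable_of_support_subset fun ξ hξ => hsub ξ ?_).mp h2
  exact right_ne_zero_of_mul hξ

/-- Translate by `η` of the dilate `[εz, ε²t]`. -/
noncomputable def dilTrans (η : Heis n) (ε : ℝ) (ζ : Heis n) : Heis n :=
  mul η ((ε : ℂ) • ζ.1, ε ^ 2 * ζ.2)

/-- The twist in the group law is a translation of `t` for fixed `z`, so the Jacobian is that of the
dilation: `ε²` from `t` and `ε^(2n)` from `z`. -/
theorem integral_dilTrans (η : Heis n) {ε : ℝ} (hε : 0 < ε) {F : Heis n → ℂ} (hF : Integrable F)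
    (hF' : Integrable fun ζ => F (dilTrans η ε ζ)) :
    ∫ ξ, F ξ = (ε ^ (2 * n + 2) : ℝ) * ∫ ζ, F (dilTrans η ε ζ) := by
  have hdim : Module.finrank ℝ (Fin n → ℂ) = 2 * n := by
    rw [Module.finrank_pi_fintype]; simp [Complex.finrank_real_complex, mul_comm]
  rw [Measure.volume_eq_prod] at hF hF' ⊢
  rw [integral_prod _ hF, integral_prod _ hF']
  have hin : ∀ z : Fin n → ℂ, ∫ t, F (η.1 + ε • z, t) =
      ((ε ^ 2 : ℝ) : ℂ) * ∫ t, F (dilTrans η ε (z, t)) := by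
    intro z
    have e1 : ∀ t : ℝ, F (dilTrans η ε (z, t)) =
        (fun u : ℝ => F (η.1 + ε • z, (η.2 + 2 * (herm η.1 ((ε : ℂ) • z)).im) + u)) (ε ^ 2 * t) := by
      intro t
      have : ((ε : ℂ) • z : Fin n → ℂ) = ε • z := by
        ext k; simp
      simp only [dilTrans, mul, this]
      congr 2
      ring
    simp only [e1]
    rw [Measure.integral_comp_mul_left
      (fun u : ℝ => F (η.1 + ε • z, (η.2 + 2 * (herm η.1 ((ε : ℂ) • z)).im) + u)),
      integral_add_left_eq_self (fun u : ℝ => F (η.1 + ε • z, u)), abs_of_pos (by positivity),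
      Complex.real_smul, ← mul_assoc, ← Complex.ofReal_mul, mul_inv_cancel₀ (by positivity),
      Complex.ofReal_one, one_mul]
  have hout : ∫ z : Fin n → ℂ, ∫ t, F (z, t) =
      ((ε ^ (2 * n) : ℝ) : ℂ) * ∫ z : Fin n → ℂ, ∫ t, F (η.1 + ε • z, t) := by
    rw [Measure.integral_comp_smul volume (fun w : Fin n → ℂ => ∫ t, F (η.1 + w, t)) ε,
      integral_add_left_eq_self (fun w : Fin n → ℂ => ∫ t, F (w, t)), hdim,
      abs_of_pos (by positivity), Complex.real_smul, ← mul_assoc, ← Complex.ofReal_mul,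
      mul_inv_cancel₀ (by positivity), Complex.ofReal_one, one_mul]
  rw [hout]
  simp only [hin]
  rw [integral_const_mul, ← mul_assoc, ← Complex.ofReal_mul, pow_add]

/-- Taking `e = ε²` makes the regularisation compatible with the dilations: `A_{ε²}` scales by
exactly `ε²`. -/
theorem regSq_dilTrans (η ζ : Heis n) (ε : ℝ) :
    regSq (ε ^ 2) η (dilTrans η ε ζ) = ε ^ 4 * ((1 + normSq ζ.1) ^ 2 + ζ.2 ^ 2) := by
  have h1 : (dilTrans η ε ζ).1 - η.1 = (ε : ℂ) • ζ.1 := by simp [dilTrans, mul]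
  have h2 : normSq ((ε : ℂ) • ζ.1) = ε ^ 2 * normSq ζ.1 := by
    simp [normSq, mul_pow, Finset.mul_sum]
  have h4 : herm η.1 (η.1 + (ε : ℂ) • ζ.1) = (normSq η.1 : ℂ) + herm η.1 ((ε : ℂ) • ζ.1) := by
    simp only [herm, normSq, Pi.add_apply, map_add, mul_add, Finset.sum_add_distrib,
      Complex.mul_conj, Complex.normSq_eq_norm_sq]
    push_cast
    rfl
  have h3 : (reg 0 η (dilTrans η ε ζ)).im = ε ^ 2 * ζ.2 := by
    rw [reg, Complex.add_im, Complex.sub_im, C_im, P]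
    simp only [dilTrans, mul]
    rw [h4]
    simp
    ring
  rw [regSq_eq, h1, h2, h3]
  ring

/-- The powers of `ε` balance: `(2n + 2) + 2 - 4 (n/2 + 1) = 0`. -/
theorem regKernel_dilTrans (η ζ : Heis n) {ε : ℝ} (hε : 0 < ε) :
    ε ^ (2 * n + 2) * (a0 n * n ^ 2 * ε ^ 2 *
      regSq (ε ^ 2) η (dilTrans η ε ζ) ^ (-((n : ℝ) / 2 + 1))) = kernel ζ := by
  rw [regSq_dilTrans, Real.mul_rpow (by positivity) (kernel_base_pos ζ).le, kernel,
    ← Real.rpow_natCast ε 4, ← Real.rpow_mul hε.le,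
    show ((4 : ℕ) : ℝ) * (-((n : ℝ) / 2 + 1)) = -((2 * n + 2 + 2 : ℕ) : ℝ) by push_cast; ring,
    Real.rpow_neg hε.le, Real.rpow_natCast, pow_add ε (2 * n + 2) 2]
  have := hε.ne'
  field_simp

theorem continuous_dilTrans (η : Heis n) : Continuous fun p : ℝ × Heis n => dilTrans η p.1 p.2 := by
  have h1 : Continuous fun p : ℝ × Heis n => ((p.1 : ℂ) • p.2.1 : Fin n → ℂ) := by fun_prop
  have h2 : Continuous fun w : Fin n → ℂ => herm η.1 w := by
    unfold herm
    exact continuous_finsetSum _ fun k _ => continuous_const.mul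
      (Complex.continuous_conj.comp (continuous_apply k))
  refine Continuous.prodMk (continuous_const.add h1) ?_
  exact (continuous_const.add ((continuous_fst.pow 2).mul (continuous_snd.comp continuous_snd))).add
    (continuous_const.mul (Complex.continuous_im.comp (h2.comp h1)))

theorem dilTrans_zero (η ζ : Heis n) : dilTrans η 0 ζ = η := by
  ext <;> simp [dilTrans, mul, herm]

theorem integrable_kernel_mul (hn : 0 < n) (η : Heis n) (ε : ℝ) {φ : Heis n → ℂ} (hc : Continuous φ)
    (hs : HasCompactSupport φ) :
    Integrable fun ζ => (kernel ζ : ℂ) * φ (dilTrans η ε ζ) := by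
  obtain ⟨M, hM⟩ := hs.exists_bound_of_continuous hc
  have h : Continuous fun ζ => φ (dilTrans η ε ζ) :=
    hc.comp ((continuous_dilTrans η).comp (continuous_const.prodMk continuous_id))
  exact ((integrable_kernel hn).ofReal (𝕜 := ℂ)).mul_bdd h.aestronglyMeasurable
    (Filter.Eventually.of_forall fun ζ => hM _)

theorem integral_regSol_mul_L0 (hn : 0 < n) (η : Heis n) {ε : ℝ} (hε : 0 < ε) {φ : Heis n → ℂ}
    (hφ : ContDiff ℝ ∞ φ) (hs : HasCompactSupport φ) :
    ∫ ξ, (regSol (ε ^ 2) η ξ : ℂ) * L0 φ ξ = ∫ ζ, (kernel ζ : ℂ) * φ (dilTrans η ε ζ) := by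
  have hε2 : 0 < ε ^ 2 := by positivity
  rw [integral_mul_L0 (contDiff_regSol hε2 η) hφ hs]
  simp only [L0_regSol η _ hε2]
  have hcc : Continuous fun ξ =>
      ((a0 n * n ^ 2 * ε ^ 2 * regSq (ε ^ 2) η ξ ^ (-((n : ℝ) / 2 + 1)) : ℝ) : ℂ) * φ ξ := by
    refine (Complex.continuous_ofReal.comp (continuous_const.mul ?_)).mul hφ.continuous
    exact (contDiff_regSq (ε ^ 2) η).continuous.rpow_const fun ξ => Or.inl (regSq_pos hε2 η ξ).ne'
  have hk : ∀ ζ, ((a0 n * n ^ 2 * ε ^ 2 * regSq (ε ^ 2) η (dilTrans η ε ζ) ^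
      (-((n : ℝ) / 2 + 1)) : ℝ) : ℂ) * φ (dilTrans η ε ζ) =
      (((ε ^ (2 * n + 2))⁻¹ : ℝ) : ℂ) * ((kernel ζ : ℂ) * φ (dilTrans η ε ζ)) := by
    intro ζ
    rw [← regKernel_dilTrans η ζ hε, ← mul_assoc, ← Complex.ofReal_mul, inv_mul_cancel_left₀
      (by positivity)]
  have hint := integrable_kernel_mul hn η ε hφ.continuous hs
  rw [integral_dilTrans η hε (hcc.integrable_of_hasCompactSupport hs.mul_left)
    (by simp only [hk]; exact hint.const_mul _)]
  simp only [hk]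
  rw [integral_const_mul, ← mul_assoc, ← Complex.ofReal_mul, mul_inv_cancel₀ (by positivity),
    Complex.ofReal_one, one_mul]

/-- `g_η` is a fundamental solution of `L₀` with pole `η`. -/
theorem integral_g_mul_L0 (hn : 2 ≤ n) (η : Heis n) {φ : Heis n → ℂ}
    (hφ : ContDiff ℝ ∞ φ) (hs : HasCompactSupport φ) :
    ∫ ξ, (g η ξ : ℂ) * L0 φ ξ = φ η := by
  have hn0 : 0 < n := by omega
  have hsq : Filter.Tendsto (fun ε : ℝ => ε ^ 2) (𝓝[>] 0) (𝓝 0) := by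
    have : Filter.Tendsto (fun ε : ℝ => ε ^ 2) (𝓝 0) (𝓝 (0 ^ 2)) := (continuous_pow 2).tendsto 0
    rw [zero_pow two_ne_zero] at this
    exact this.mono_left nhdsWithin_le_nhds
  have h1 : Filter.Tendsto (fun ε : ℝ => ∫ ξ, (regSol (ε ^ 2) η ξ : ℂ) * L0 φ ξ) (𝓝[>] 0)
      (𝓝 (∫ ξ, (g η ξ : ℂ) * L0 φ ξ)) := by
    refine tendsto_integral_filter_of_dominated_convergence
      (fun ξ => ‖(g η ξ : ℂ) * L0 φ ξ‖) ?_ ?_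
      (integrable_g_mul hn η (continuous_L0 hφ) (hasCompactSupport_L0 hs)).norm ?_
    · filter_upwards [self_mem_nhdsWithin] with ε (hε : 0 < ε)
      exact ((contDiff_regSol (by positivity) η).continuous.mul
        (continuous_L0 hφ)).aestronglyMeasurable
    · filter_upwards with ε
      filter_upwards [ae_fst_ne hn0 η.1] with ξ hξ
      rw [norm_mul, norm_mul, Complex.norm_real, Complex.norm_real,
        Real.norm_of_nonneg (regSol_nonneg _ _ _), Real.norm_of_nonneg (g_nonneg _ _)]
      exact mul_le_mul_of_nonneg_right (regSol_le_g (by positivity) hξ) (norm_nonneg _)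
    · filter_upwards [ae_fst_ne hn0 η.1] with ξ hξ
      exact ((Complex.continuous_ofReal.tendsto _).comp
        ((tendsto_regSol hξ).comp hsq)).mul_const _
  -- The kernel side concentrates at the pole: the dilated point tends to `η`, and the kernel has
  -- mass one.
  have h2 : Filter.Tendsto (fun ε : ℝ => ∫ ζ, (kernel ζ : ℂ) * φ (dilTrans η ε ζ)) (𝓝[>] 0)
      (𝓝 (∫ ζ : Heis n, (kernel ζ : ℂ) * φ η)) := by
    obtain ⟨M, hM⟩ := hs.exists_bound_of_continuous hφ.continuous
    refine tendsto_integral_filter_of_dominated_convergence (fun ζ => ‖(kernel ζ : ℂ)‖ * M) ?_ ?_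
      (((integrable_kernel hn0).ofReal (𝕜 := ℂ)).norm.mul_const M) ?_
    · filter_upwards with ε
      exact (integrable_kernel_mul hn0 η ε hφ.continuous hs).aestronglyMeasurable
    · filter_upwards with ε
      filter_upwards with ζ
      rw [norm_mul]
      exact mul_le_mul_of_nonneg_left (hM _) (norm_nonneg _)
    · filter_upwards with ζ
      have hc : Continuous fun ε : ℝ => φ (dilTrans η ε ζ) :=
        hφ.continuous.comp ((continuous_dilTrans η).comp (continuous_id.prodMk continuous_const))
      have := (hc.tendsto 0).mono_left (nhdsWithin_le_nhds (s := Ioi (0 : ℝ)))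
      rw [dilTrans_zero] at this
      exact this.const_mul _
  have h3 : ∫ ζ : Heis n, (kernel ζ : ℂ) = ((∫ ζ : Heis n, kernel ζ : ℝ) : ℂ) := integral_ofReal
  rw [integral_mul_const, h3, integral_kernel hn0, Complex.ofReal_one, one_mul] at h2
  refine tendsto_nhds_unique h1 (h2.congr' ?_)
  filter_upwards [self_mem_nhdsWithin] with ε (hε : 0 < ε)
  exact (integral_regSol_mul_L0 hn0 η hε hφ hs).symm

end Heisenberg

/-! ### Averaging over the pole -/

namespace Heisenberg

open MeasureTheory Set
open scoped ENNReal

variable {n : ℕ}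

theorem ae_notMem_circleThrough (η : Heis n) : ∀ᵐ ξ : Heis n, ξ ∉ circleThrough η := by
  have h : (volume : Measure (Heis n)) (Prod.snd ⁻¹' {η.2}) = 0 := by
    rw [← Set.univ_prod, Measure.volume_eq_prod, Measure.prod_prod, measure_singleton, mul_zero]
  filter_upwards [compl_mem_ae_iff.mpr h] with ξ hξ hmem
  exact hξ (snd_eq_of_mem_circleThrough hmem)

theorem continuous_rot_uncurry (η : Heis n) : Continuous fun θ : ℝ => rot θ η := by
  unfold rot; fun_prop

theorem norm_rot_fst_le (θ : ℝ) (η : Heis n) : ‖(rot θ η).1‖ ≤ ‖η.1‖ := by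
  refine (pi_norm_le_iff_of_nonneg (norm_nonneg _)).mpr fun j => ?_
  simp only [rot, norm_mul, Complex.norm_exp_ofReal_mul_I, one_mul]
  exact norm_le_pi_norm η.1 j

/-- This justifies Fubini in `(ξ, θ)`: the bound in `lintegral_g_le` is uniform in the pole, and
rotations do not increase `‖η.1‖`. -/
theorem integrable_g_rot_prod (hn : 2 ≤ n) (η : Heis n) {R : ℝ} (hR : ‖η.1‖ ≤ R) :
    Integrable (fun p : Heis n × ℝ => g (rot (-p.2) η) p.1)
      ((volume.restrict (Metric.ball (0 : Fin n → ℂ) R ×ˢ univ)).prod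
        (volume.restrict (Ioc 0 (2 * Real.pi)))) := by
  obtain ⟨B, hB, hle⟩ := lintegral_g_le hn R
  have hm : Measurable fun p : Heis n × ℝ => g (rot (-p.2) η) p.1 := by
    have h1 : Measurable fun p : Heis n × ℝ => (rot (-p.2) η, p.1) :=
      (((continuous_rot_uncurry η).comp continuous_snd.neg).prodMk continuous_fst).measurable
    have h2 := measurable_g_uncurry.comp h1
    exact h2
  refine ⟨hm.aestronglyMeasurable, ?_⟩
  rw [hasFiniteIntegral_iff_ofReal (Filter.Eventually.of_forall fun p => g_nonneg _ _),
    lintegral_prod_symm _ hm.ennreal_ofReal.aemeasurable]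
  calc _ ≤ ∫⁻ _ in Ioc 0 (2 * Real.pi), B :=
        lintegral_mono fun θ => hle _ ((norm_rot_fst_le _ _).trans hR)
    _ < ⊤ := by
        rw [setLIntegral_const]
        exact ENNReal.mul_lt_top hB.lt_top measure_Ioc_lt_top

theorem H_ae_eq (η : Heis n) : ∀ᵐ ξ : Heis n, H η.2 η ξ =
    (2 * Real.pi)⁻¹ * ∫ θ in Ioc 0 (2 * Real.pi), g (rot (-θ) η) ξ := by
  filter_upwards [ae_notMem_circleThrough η] with ξ hξ
  rw [H_eq_average (s := η.2) (η := η) hξ, average, smul_eq_mul,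
    intervalIntegral.integral_of_le Real.two_pi_pos.le]
  simp only [g_rot]

theorem integrableOn_H (hn : 2 ≤ n) (η : Heis n) {R : ℝ} (hR : ‖η.1‖ ≤ R) :
    IntegrableOn (H η.2 η) (Metric.ball (0 : Fin n → ℂ) R ×ˢ univ) :=
  (((integrable_g_rot_prod hn η hR).integral_prod_left).const_mul (2 * Real.pi)⁻¹).congr
    (ae_restrict_of_ae ((H_ae_eq η).mono fun _ h => h.symm))

theorem locallyIntegrable_H (hn : 2 ≤ n) (η : Heis n) : LocallyIntegrable (H η.2 η) := by
  intro ξ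
  refine ⟨Metric.ball (0 : Fin n → ℂ) (max ‖η.1‖ (‖ξ.1‖ + 1)) ×ˢ univ, ?_,
    integrableOn_H hn η (le_max_left _ _)⟩
  refine (Metric.isOpen_ball.prod isOpen_univ).mem_nhds ⟨?_, mem_univ _⟩
  rw [mem_ball_zero_iff]
  exact lt_max_of_lt_right (lt_add_one _)

theorem integrable_H_mul (hn : 2 ≤ n) (η : Heis n) {ψ : Heis n → ℂ} (hc : Continuous ψ)
    (hs : HasCompactSupport ψ) : Integrable fun ξ => (H η.2 η ξ : ℂ) * ψ ξ := by
  obtain ⟨R, hR, hsub⟩ := exists_tsupport_subset_ball hs ‖η.1‖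
  obtain ⟨M, hM⟩ := hs.exists_bound_of_continuous hc
  have h1 := (integrableOn_H hn η hR).ofReal (𝕜 := ℂ)
  have h2 : IntegrableOn (fun ξ => (H η.2 η ξ : ℂ) * ψ ξ) (Metric.ball (0 : Fin n → ℂ) R ×ˢ univ) :=
    h1.mul_bdd hc.aestronglyMeasurable (Filter.Eventually.of_forall hM)
  refine (integrableOn_iff_integrable_of_support_subset fun ξ hξ => hsub ξ ?_).mp h2
  exact right_ne_zero_of_mul hξ

theorem rot_periodic (η : Heis n) : Function.Periodic (fun θ : ℝ => rot θ η) (2 * Real.pi) := by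
  intro θ
  simp only [rot]
  congr 1
  funext j
  congr 1
  have : ((θ + 2 * Real.pi : ℝ) : ℂ) * Complex.I = θ * Complex.I + 2 * Real.pi * Complex.I := by
    push_cast; ring
  rw [this, Complex.exp_periodic]

/-- `L₀ H(s)` is the uniform mass on the circle through the pole. -/
theorem integral_H_mul_L0 (hn : 2 ≤ n) (η : Heis n) {φ : Heis n → ℂ}
    (hφ : ContDiff ℝ ∞ φ) (hs : HasCompactSupport φ) :
    ∫ ξ, (H η.2 η ξ : ℂ) * L0 φ ξ = average φ η := by
  have hLc := continuous_L0 hφ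
  have hLs := hasCompactSupport_L0 hs
  obtain ⟨R, hR, hsub⟩ := exists_tsupport_subset_ball hLs ‖η.1‖
  obtain ⟨M, hM⟩ := hLs.exists_bound_of_continuous hLc
  set S : Set (Heis n) := Metric.ball (0 : Fin n → ℂ) R ×ˢ univ with hS
  have hzero : ∀ (f : Heis n → ℂ), ∫ ξ in S, f ξ * L0 φ ξ = ∫ ξ, f ξ * L0 φ ξ := by
    intro f
    refine setIntegral_eq_integral_of_forall_compl_eq_zero fun ξ hξ => ?_
    by_cases h : L0 φ ξ = 0
    · rw [h, mul_zero]
    · exact absurd (hsub ξ h) hξ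
  have hprod : Integrable (fun p : Heis n × ℝ => (g (rot (-p.2) η) p.1 : ℂ) * L0 φ p.1)
      ((volume.restrict S).prod (volume.restrict (Ioc 0 (2 * Real.pi)))) :=
    ((integrable_g_rot_prod hn η hR).ofReal (𝕜 := ℂ)).mul_bdd
      (hLc.comp continuous_fst).aestronglyMeasurable (Filter.Eventually.of_forall fun p => hM _)
  have hH : ∀ᵐ ξ : Heis n ∂(volume.restrict S), (H η.2 η ξ : ℂ) * L0 φ ξ =
      (((2 * Real.pi)⁻¹ : ℝ) : ℂ) *
        ∫ θ in Ioc 0 (2 * Real.pi), (g (rot (-θ) η) ξ : ℂ) * L0 φ ξ := by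
    refine ae_restrict_of_ae ((H_ae_eq η).mono fun ξ h => ?_)
    have h1 : ∫ θ in Ioc 0 (2 * Real.pi), (g (rot (-θ) η) ξ : ℂ) =
      ((∫ θ in Ioc 0 (2 * Real.pi), g (rot (-θ) η) ξ : ℝ) : ℂ) := integral_ofReal
    rw [h, integral_mul_const, h1, Complex.ofReal_mul, mul_assoc]
  rw [← hzero, integral_congr_ae hH, integral_const_mul, integral_integral_swap hprod]
  simp only [hzero, integral_g_mul_L0 hn _ hφ hs]
  rw [average, ← Complex.real_smul, ← intervalIntegral.integral_of_le Real.two_pi_pos.le,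
    intervalIntegral.integral_comp_neg (fun θ => φ (rot θ η))]
  congr 1
  -- The poles were traversed as `-θ`; periodicity moves the interval `[-2π, 0]` back to `[0, 2π]`.
  have hper : Function.Periodic (fun θ : ℝ => φ (rot θ η)) (2 * Real.pi) :=
    (rot_periodic η).comp φ
  have := hper.intervalIntegral_add_eq (-(2 * Real.pi)) 0
  simpa using this

/-- `H s η` uses only the `z`-coordinate of `η`, so `η` may be replaced by the pole `[z, s]`
definitionally. -/
theorem integrable_H_mul' (hn : 2 ≤ n) (s : ℝ) (η : Heis n) {ψ : Heis n → ℂ} (hc : Continuous ψ)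
    (hs : HasCompactSupport ψ) : Integrable fun ξ => (H s η ξ : ℂ) * ψ ξ :=
  integrable_H_mul hn ((η.1, s) : Heis n) hc hs

theorem integral_H_mul_L0' (hn : 2 ≤ n) (s : ℝ) (η : Heis n) {φ : Heis n → ℂ}
    (hφ : ContDiff ℝ ∞ φ) (hs : HasCompactSupport φ) :
    ∫ ξ, (H s η ξ : ℂ) * L0 φ ξ = average φ ((η.1, s) : Heis n) :=
  integral_H_mul_L0 hn ((η.1, s) : Heis n) hφ hs

theorem summable_integral_norm_H_mul (hn : 2 ≤ n) {s : ℕ → ℝ} (hs : ∀ m : ℕ, (m : ℝ) ≤ |s m|)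
    (η : Heis n) {ψ : Heis n → ℂ} (hc : Continuous ψ) (hψ : HasCompactSupport ψ) :
    Summable fun m => ∫ ξ, ‖(H (s m) η ξ : ℂ) * ψ ξ‖ := by
  refine Summable.of_norm_bounded_eventually (((summable_abs_inv_pow hs hn).mul_left
    (a0 n * 2 ^ n)).mul_right (∫ ξ, ‖ψ ξ‖)) ?_
  rw [Nat.cofinite_eq_atTop]
  filter_upwards [eventually_abs_H_le hs η hψ] with m hm
  rw [Real.norm_of_nonneg (integral_nonneg fun _ => norm_nonneg _), ← integral_const_mul]
  refine integral_mono (integrable_H_mul' hn _ η hc hψ).norm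
    ((hc.integrable_of_hasCompactSupport hψ).norm.const_mul _) fun ξ => ?_
  dsimp only
  by_cases hξ : ξ ∈ tsupport ψ
  · rw [norm_mul, Complex.norm_real]
    exact mul_le_mul_of_nonneg_right (hm ξ hξ) (norm_nonneg _)
  · simp [image_eq_zero_of_notMem_tsupport hξ]

/-- This is the reflection symmetry behind the images: poles at equal distance from a horizontal
plane give equal values of `H` on it. -/
theorem H_congr {s s' : ℝ} {η ξ : Heis n} (h : (ξ.2 - s) ^ 2 = (ξ.2 - s') ^ 2) :
    H s η ξ = H s' η ξ := by
  rw [H_eq_profile, H_eq_profile, norm_C_sq, norm_C_sq, h]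

/-! ### The image series and the Green's function -/

section Green

variable {η : Heis n}

theorem le_abs_pole_one (hη : η ∈ strip n) (m : ℕ) : (m : ℝ) ≤ |2 * (m : ℝ) + η.2| := by
  have h := hη.1
  have hm : (0 : ℝ) ≤ m := Nat.cast_nonneg m
  exact le_abs.mpr (Or.inl (by linarith))

theorem le_abs_pole_two (hη : η ∈ strip n) (m : ℕ) : (m : ℝ) ≤ |-2 * (m : ℝ) - η.2| := by
  have h := hη.1
  have hm : (0 : ℝ) ≤ m := Nat.cast_nonneg m
  exact le_abs.mpr (Or.inr (by linarith))

theorem le_abs_pole_three (hη : η ∈ strip n) (m : ℕ) :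
    (m : ℝ) ≤ |-2 * ((m : ℝ) + 1) + η.2| := by
  have h := hη.2
  have hm : (0 : ℝ) ≤ m := Nat.cast_nonneg m
  exact le_abs.mpr (Or.inr (by linarith))

theorem le_abs_pole_four (hη : η ∈ strip n) (m : ℕ) : (m : ℝ) ≤ |2 * ((m : ℝ) + 1) - η.2| := by
  have h := hη.2
  have hm : (0 : ℝ) ≤ m := Nat.cast_nonneg m
  exact le_abs.mpr (Or.inl (by linarith))

theorem le_abs_pole_one_succ (hη : η ∈ strip n) (m : ℕ) :
    (m : ℝ) ≤ |2 * ((m : ℝ) + 1) + η.2| := by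
  have h := hη.1
  have hm : (0 : ℝ) ≤ m := Nat.cast_nonneg m
  exact le_abs.mpr (Or.inl (by linarith))

theorem notMem_circleThrough_of_ne {s : ℝ} {ξ : Heis n} (h : ξ.2 ≠ s) :
    ξ ∉ circleThrough ((η.1, s) : Heis n) := fun hmem => h (snd_eq_of_mem_circleThrough hmem)

/-- `G'` is smooth on the closed strip off the circle through `η`. -/
theorem contDiffAt_G' (hn : 2 ≤ n) (hη : η ∈ strip n) {ξ : Heis n} (h0 : 0 ≤ ξ.2) (h1 : ξ.2 ≤ 1)
    (hξ : ξ ∉ circleThrough η) : ContDiffAt ℝ ∞ (G' η) ξ := by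
  have ht0 := hη.1
  have ht1 := hη.2
  refine (((contDiffAt_tsum_H hn (le_abs_pole_one hη) fun m => ?_).sub
    (contDiffAt_tsum_H hn (le_abs_pole_two hη) fun m => ?_)).add
    (contDiffAt_tsum_H hn (le_abs_pole_three hη) fun m => ?_)).sub
    (contDiffAt_tsum_H hn (le_abs_pole_four hη) fun m => ?_)
  -- The pole at height `t` is the only one in the closed strip, and it is avoided by `hξ`. All
  -- others are excluded by height.
  · rcases m with _ | m
    · simpa using hξ
    · refine notMem_circleThrough_of_ne (ne_of_lt ?_)
      have hm : (0 : ℝ) ≤ m := Nat.cast_nonneg m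
      push_cast
      linarith
  all_goals have hm : (0 : ℝ) ≤ m := Nat.cast_nonneg m
  · exact notMem_circleThrough_of_ne (ne_of_gt (by linarith))
  · exact notMem_circleThrough_of_ne (ne_of_gt (by linarith))
  · exact notMem_circleThrough_of_ne (ne_of_lt (by linarith))

theorem tsum_H_pole_one (hn : 2 ≤ n) (hη : η ∈ strip n) (ξ : Heis n) :
    ∑' m : ℕ, H (2 * (m : ℝ) + η.2) η ξ =
      H η.2 η ξ + ∑' m : ℕ, H (2 * ((m : ℝ) + 1) + η.2) η ξ := by
  rw [(summable_H (le_abs_pole_one hη) hn η ξ).tsum_eq_zero_add]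
  simp

theorem contDiffAt_G'_sub_H (hn : 2 ≤ n) (hη : η ∈ strip n) {ξ : Heis n} (hξ : ξ ∈ strip n) :
    ContDiffAt ℝ ∞ (fun ξ => G' η ξ - H η.2 η ξ) ξ := by
  have ht0 := hη.1
  have ht1 := hη.2
  have hx0 := hξ.1
  have hx1 := hξ.2
  have heq : (fun ξ => G' η ξ - H η.2 η ξ) = fun ξ =>
      (∑' m : ℕ, H (2 * ((m : ℝ) + 1) + η.2) η ξ) - (∑' m : ℕ, H (-2 * (m : ℝ) - η.2) η ξ)
        + (∑' m : ℕ, H (-2 * ((m : ℝ) + 1) + η.2) η ξ)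
        - (∑' m : ℕ, H (2 * ((m : ℝ) + 1) - η.2) η ξ) := by
    funext ξ
    rw [G', tsum_H_pole_one hn hη]
    ring
  rw [heq]
  refine (((contDiffAt_tsum_H hn (le_abs_pole_one_succ hη) fun m => ?_).sub
    (contDiffAt_tsum_H hn (le_abs_pole_two hη) fun m => ?_)).add
    (contDiffAt_tsum_H hn (le_abs_pole_three hη) fun m => ?_)).sub
    (contDiffAt_tsum_H hn (le_abs_pole_four hη) fun m => ?_)
  all_goals have hm : (0 : ℝ) ≤ m := Nat.cast_nonneg m
  · exact notMem_circleThrough_of_ne (ne_of_lt (by linarith))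
  · exact notMem_circleThrough_of_ne (ne_of_gt (by linarith))
  · exact notMem_circleThrough_of_ne (ne_of_gt (by linarith))
  · exact notMem_circleThrough_of_ne (ne_of_lt (by linarith))

/-- The reflection `s ↦ -s` exchanges the first series with the second and the third with the
fourth, term by term. -/
theorem G'_bottom (w : Fin n → ℂ) : G' η ((w, 0) : Heis n) = 0 := by
  have h1 : ∀ m : ℕ, H (2 * (m : ℝ) + η.2) η ((w, 0) : Heis n) =
      H (-2 * (m : ℝ) - η.2) η (w, 0) := fun m => H_congr (by ring)
  have h2 : ∀ m : ℕ, H (-2 * ((m : ℝ) + 1) + η.2) η ((w, 0) : Heis n) =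
      H (2 * ((m : ℝ) + 1) - η.2) η (w, 0) := fun m => H_congr (by ring)
  rw [G', tsum_congr h1, tsum_congr h2]
  ring

/-- The reflection `s ↦ 2 - s` matches the series with an index shift: `2(m+1) + t` with `-2m - t`,
`2(m+2) - t` with `-2(m+1) + t`, and the two leftover poles `t` and `2 - t` with each other. -/
theorem G'_top (hn : 2 ≤ n) (hη : η ∈ strip n) (w : Fin n → ℂ) : G' η ((w, 1) : Heis n) = 0 := by
  have h1 : ∀ m : ℕ, H (2 * ((m : ℝ) + 1) + η.2) η ((w, 1) : Heis n) =
      H (-2 * (m : ℝ) - η.2) η (w, 1) := fun m => H_congr (by ring)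
  have h2 : ∀ m : ℕ, H (2 * (((m + 1 : ℕ) : ℝ) + 1) - η.2) η ((w, 1) : Heis n) =
      H (-2 * ((m : ℝ) + 1) + η.2) η (w, 1) := fun m => H_congr (by push_cast; ring)
  have h3 : H (2 * (((0 : ℕ) : ℝ) + 1) - η.2) η ((w, 1) : Heis n) = H η.2 η (w, 1) :=
    H_congr (by push_cast; ring)
  rw [G', tsum_H_pole_one hn hη, tsum_congr h1,
    (summable_H (le_abs_pole_four hη) hn η _).tsum_eq_zero_add, tsum_congr h2, h3]
  ring

/-- `G'` is smooth in a full neighbourhood of a boundary point, so its limit there is its value. -/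
theorem tendsto_G' (hn : 2 ≤ n) (hη : η ∈ strip n) {ξ : Heis n} (h0 : 0 ≤ ξ.2) (h1 : ξ.2 ≤ 1)
    (hne : ξ.2 ≠ η.2) (hG : G' η ξ = 0) :
    Filter.Tendsto (G' η) (𝓝[strip n] ξ) (𝓝 0) := by
  have h := (contDiffAt_G' hn hη h0 h1 fun hmem =>
    hne (snd_eq_of_mem_circleThrough hmem)).continuousAt.tendsto
  rw [hG] at h
  exact h.mono_left nhdsWithin_le_nhds

theorem isOpen_strip : IsOpen (strip n) :=
  (isOpen_lt continuous_const continuous_snd).inter (isOpen_lt continuous_snd continuous_const)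

theorem isClosed_circleThrough (η : Heis n) : IsClosed (circleThrough η) := by
  have h : circleThrough η = (fun θ : ℝ => rot θ η) '' Icc 0 (2 * Real.pi) := by
    have := (rot_periodic η).image_Icc Real.two_pi_pos 0
    rw [zero_add] at this
    rw [this, circleThrough]
  rw [h]
  exact (isCompact_Icc.image (continuous_rot_uncurry η)).isClosed

/-- Image poles outside the strip are invisible to test functions supported inside it. -/
theorem average_eq_zero {φ : Heis n → ℂ} (hφ : tsupport φ ⊆ strip n) {s : ℝ}
    (hs : s ≤ 0 ∨ 1 ≤ s) : average φ ((η.1, s) : Heis n) = 0 := by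
  have h : ∀ θ : ℝ, φ (rot θ ((η.1, s) : Heis n)) = 0 := by
    intro θ
    refine image_eq_zero_of_notMem_tsupport fun hmem => ?_
    have h1 : 0 < s := (hφ hmem).1
    have h2 : s < 1 := (hφ hmem).2
    rcases hs with hs | hs <;> linarith
  simp [average, h]

theorem G'_eq_tsum (hn : 2 ≤ n) (hη : η ∈ strip n) (ξ : Heis n) :
    G' η ξ = ∑' m : ℕ, (H (2 * (m : ℝ) + η.2) η ξ - H (-2 * (m : ℝ) - η.2) η ξ +
      H (-2 * ((m : ℝ) + 1) + η.2) η ξ - H (2 * ((m : ℝ) + 1) - η.2) η ξ) := by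
  have s1 := summable_H (le_abs_pole_one hη) hn η ξ
  have s2 := summable_H (le_abs_pole_two hη) hn η ξ
  have s3 := summable_H (le_abs_pole_three hη) hn η ξ
  have s4 := summable_H (le_abs_pole_four hη) hn η ξ
  rw [((s1.sub s2).add s3).tsum_sub s4, (s1.sub s2).tsum_add s3, s1.tsum_sub s2, G']

/-- As a distribution on the strip, `L₀ G'` is the uniform mass on the circle through `η`. -/
theorem integral_G'_mul_L0 (hn : 2 ≤ n) (hη : η ∈ strip n) {φ : Heis n → ℂ} (hφ : IsTest φ) :
    ∫ ξ in strip n, (G' η ξ : ℂ) * L0 φ ξ = average φ η := by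
  obtain ⟨hc, hs, hsub⟩ := hφ
  have ht0 := hη.1
  have ht1 := hη.2
  have hLc := continuous_L0 hc
  have hLs := hasCompactSupport_L0 hs
  -- `L₀ φ` vanishes off the strip, so the whole-space identity for each `H(s)` applies.
  rw [setIntegral_eq_integral_of_forall_compl_eq_zero fun ξ hξ => by
    rw [L0_eq_zero_of_notMem_tsupport fun h => hξ (hsub h), mul_zero]]
  have hI : ∀ s, Integrable fun ξ => (H s η ξ : ℂ) * L0 φ ξ := fun s =>
    integrable_H_mul' hn s η hLc hLs
  set F : ℕ → Heis n → ℂ := fun m ξ =>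
    (H (2 * (m : ℝ) + η.2) η ξ : ℂ) * L0 φ ξ - (H (-2 * (m : ℝ) - η.2) η ξ : ℂ) * L0 φ ξ +
      (H (-2 * ((m : ℝ) + 1) + η.2) η ξ : ℂ) * L0 φ ξ -
      (H (2 * ((m : ℝ) + 1) - η.2) η ξ : ℂ) * L0 φ ξ with hF
  have i2 : ∀ s s', Integrable fun ξ => (H s η ξ : ℂ) * L0 φ ξ - (H s' η ξ : ℂ) * L0 φ ξ :=
    fun s s' => (hI s).sub (hI s')
  have i3 : ∀ s s' s'', Integrable fun ξ => (H s η ξ : ℂ) * L0 φ ξ - (H s' η ξ : ℂ) * L0 φ ξ +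
      (H s'' η ξ : ℂ) * L0 φ ξ := fun s s' s'' => (i2 s s').add (hI s'')
  have hFI : ∀ m, Integrable (F m) := fun m => (i3 _ _ _).sub (hI _)
  have hGF : ∀ ξ, (G' η ξ : ℂ) * L0 φ ξ = ∑' m, F m ξ := by
    intro ξ
    rw [G'_eq_tsum hn hη, Complex.ofReal_tsum, ← tsum_mul_right]
    refine tsum_congr fun m => ?_
    simp only [hF]
    push_cast
    ring
  have hsumm : Summable fun m => ∫ ξ, ‖F m ξ‖ := by
    have hb := (((summable_integral_norm_H_mul hn (le_abs_pole_one hη) η hLc hLs).add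
      (summable_integral_norm_H_mul hn (le_abs_pole_two hη) η hLc hLs)).add
      (summable_integral_norm_H_mul hn (le_abs_pole_three hη) η hLc hLs)).add
      (summable_integral_norm_H_mul hn (le_abs_pole_four hη) η hLc hLs)
    refine Summable.of_nonneg_of_le (fun m => integral_nonneg fun _ => norm_nonneg _)
      (fun m => ?_) hb
    have j2 : ∀ s s', Integrable fun ξ =>
        ‖(H s η ξ : ℂ) * L0 φ ξ‖ + ‖(H s' η ξ : ℂ) * L0 φ ξ‖ :=
      fun s s' => (hI s).norm.add (hI s').norm
    have j3 : ∀ s s' s'', Integrable fun ξ => ‖(H s η ξ : ℂ) * L0 φ ξ‖ +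
        ‖(H s' η ξ : ℂ) * L0 φ ξ‖ + ‖(H s'' η ξ : ℂ) * L0 φ ξ‖ :=
      fun s s' s'' => (j2 s s').add (hI s'').norm
    rw [← integral_add (hI _).norm (hI _).norm, ← integral_add (j2 _ _) (hI _).norm,
      ← integral_add (j3 _ _ _) (hI _).norm]
    refine integral_mono (hFI m).norm ((j3 _ _ _).add (hI _).norm) fun ξ => ?_
    refine (norm_sub_le _ _).trans (add_le_add_left ?_ _)
    refine (norm_add_le _ _).trans (add_le_add_left ?_ _)
    exact norm_sub_le _ _
  -- Each image contributes the average of `φ` on its own circle; only the pole of the first series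
  -- at `m = 0` lies in the strip.
  have hval : ∀ m, ∫ ξ, F m ξ = if m = 0 then average φ η else 0 := by
    intro m
    simp only [hF]
    rw [integral_sub (i3 _ _ _) (hI _), integral_add (i2 _ _) (hI _), integral_sub (hI _) (hI _)]
    simp only [integral_H_mul_L0' hn _ η hc hs]
    have hm : (0 : ℝ) ≤ m := Nat.cast_nonneg m
    rw [average_eq_zero hsub (s := -2 * (m : ℝ) - η.2) (Or.inl (by linarith)),
      average_eq_zero hsub (s := -2 * ((m : ℝ) + 1) + η.2) (Or.inl (by linarith)),
      average_eq_zero hsub (s := 2 * ((m : ℝ) + 1) - η.2) (Or.inr (by linarith)),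
      sub_zero, add_zero, sub_zero]
    split_ifs with h
    · subst h
      simp
    · have hm1 : (1 : ℝ) ≤ m := by exact_mod_cast Nat.one_le_iff_ne_zero.mpr h
      exact average_eq_zero hsub (Or.inr (by linarith))
  simp only [hGF]
  rw [← (hasSum_integral_of_summable_integral_norm hFI hsumm).tsum_eq]
  simp only [hval, tsum_ite_eq]

theorem average_eq_of_isCircular {φ : Heis n → ℂ} (h : IsCircular φ) (ξ : Heis n) :
    average φ ξ = φ ξ := by
  have hpi : (2 * Real.pi) ≠ 0 := Real.two_pi_pos.ne'
  simp only [average, h _ ξ]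
  rw [intervalIntegral.integral_const, sub_zero, smul_smul, inv_mul_cancel₀ hpi, one_smul]

end Green

end Heisenberg

theorem theorem3p1 (n : ℕ) (hn : 2 ≤ n) (η : Heisenberg.Heis n) (hη : η ∈ Heisenberg.strip n) :
    -- `H(s)` is the circular average of the fundamental solution with pole `[z, s]`
    (∀ (s : ℝ) (ξ : Heisenberg.Heis n), ξ ∉ Heisenberg.circleThrough (η.1, s) →
      Heisenberg.H s η ξ = Heisenberg.average (Heisenberg.g (η.1, s)) ξ) ∧
    -- each of the four series converges locally uniformly off the circle through `η`
    SummableLocallyUniformlyOn (fun (m : ℕ) ξ => Heisenberg.H (2 * (m : ℝ) + η.2) η ξ)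
      (Heisenberg.strip n \ Heisenberg.circleThrough η) ∧
    SummableLocallyUniformlyOn (fun (m : ℕ) ξ => Heisenberg.H (-2 * (m : ℝ) - η.2) η ξ)
      (Heisenberg.strip n \ Heisenberg.circleThrough η) ∧
    SummableLocallyUniformlyOn (fun (m : ℕ) ξ => Heisenberg.H (-2 * ((m : ℝ) + 1) + η.2) η ξ)
      (Heisenberg.strip n \ Heisenberg.circleThrough η) ∧
    SummableLocallyUniformlyOn (fun (m : ℕ) ξ => Heisenberg.H (2 * ((m : ℝ) + 1) - η.2) η ξ)
      (Heisenberg.strip n \ Heisenberg.circleThrough η) ∧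
    -- `G'` is smooth off the circle through `η`, and `G' - H(t)` is smooth on the whole strip
    ContDiffOn ℝ ∞ (Heisenberg.G' η) (Heisenberg.strip n \ Heisenberg.circleThrough η) ∧
    ContDiffOn ℝ ∞ (fun ξ => Heisenberg.G' η ξ - Heisenberg.H η.2 η ξ) (Heisenberg.strip n) ∧
    -- `L₀ G'` is, as a distribution on the strip, the uniform mass on the circle through `η`
    MeasureTheory.LocallyIntegrableOn (Heisenberg.G' η) (Heisenberg.strip n) ∧
    (∀ φ : Heisenberg.Heis n → ℂ, Heisenberg.IsTest φ →
      ∫ ξ in Heisenberg.strip n, (Heisenberg.G' η ξ : ℂ) * Heisenberg.L0 φ ξ =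
        Heisenberg.average φ η) ∧
    -- so `L₀ G' = δ_η` on circular test functions
    (∀ φ : Heisenberg.Heis n → ℂ, Heisenberg.IsTest φ → Heisenberg.IsCircular φ →
      ∫ ξ in Heisenberg.strip n, (Heisenberg.G' η ξ : ℂ) * Heisenberg.L0 φ ξ = φ η) ∧
    -- `G'` has boundary values zero on `t' = 0` and on `t' = 1`
    (∀ w : Fin n → ℂ, Filter.Tendsto (Heisenberg.G' η)
      (𝓝[Heisenberg.strip n] ((w, 0) : Heisenberg.Heis n)) (𝓝 0)) ∧
    (∀ w : Fin n → ℂ, Filter.Tendsto (Heisenberg.G' η)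
      (𝓝[Heisenberg.strip n] ((w, 1) : Heisenberg.Heis n)) (𝓝 0)) := by
  have hU := Heisenberg.isOpen_strip.sdiff (Heisenberg.isClosed_circleThrough η)
  have hsub : ContDiffOn ℝ ∞ (fun ξ => Heisenberg.G' η ξ - Heisenberg.H η.2 η ξ)
      (Heisenberg.strip n) := fun ξ hξ =>
    (Heisenberg.contDiffAt_G'_sub_H hn hη hξ).contDiffWithinAt
  refine ⟨fun s ξ h => Heisenberg.H_eq_average h, ?_, ?_, ?_, ?_, ?_, ?_, ?_, ?_, ?_, ?_, ?_⟩
  · exact Heisenberg.summableLocallyUniformlyOn_H (Heisenberg.le_abs_pole_one hη) hn η hU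
  · exact Heisenberg.summableLocallyUniformlyOn_H (Heisenberg.le_abs_pole_two hη) hn η hU
  · exact Heisenberg.summableLocallyUniformlyOn_H (Heisenberg.le_abs_pole_three hη) hn η hU
  · exact Heisenberg.summableLocallyUniformlyOn_H (Heisenberg.le_abs_pole_four hη) hn η hU
  · exact fun ξ hξ =>
      (Heisenberg.contDiffAt_G' hn hη hξ.1.1.le hξ.1.2.le hξ.2).contDiffWithinAt
  · exact hsub
  -- `G'` is the sum of `G' - H(t)`, continuous on the strip, and `H(t)`, locally integrable across
  -- its singular circle.
  · have h1 := hsub.continuousOn.locallyIntegrableOn (μ := MeasureTheory.volume)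
      Heisenberg.isOpen_strip.measurableSet
    have h2 := (Heisenberg.locallyIntegrable_H hn η).locallyIntegrableOn (Heisenberg.strip n)
    have h3 := h1.add h2
    have h4 : (fun ξ => Heisenberg.G' η ξ - Heisenberg.H η.2 η ξ) + Heisenberg.H η.2 η =
        Heisenberg.G' η := by
      funext ξ
      simp
    rwa [h4] at h3
  · exact fun φ hφ => Heisenberg.integral_G'_mul_L0 hn hη hφ
  · exact fun φ hφ hcirc => (Heisenberg.integral_G'_mul_L0 hn hη hφ).trans
      (Heisenberg.average_eq_of_isCircular hcirc η)
  · exact fun w => Heisenberg.tendsto_G' hn hη le_rfl zero_le_one hη.1.ne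
      (Heisenberg.G'_bottom w)
  · exact fun w => Heisenberg.tendsto_G' hn hη zero_le_one le_rfl hη.2.ne'
      (Heisenberg.G'_top hn hη w)
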